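/- Let $Q$ be a finite acyclic quiver of affine type with vertex set $I$, let $\delta\in\mathbb{N}I$ be its minimal positive imaginary root and $|\delta|=\sum_{i\in I}\delta_i$. Let $k=\mathbb{F}_q$ be a finite field, $v_q=\sqrt q$, and let $\mathcal{H}^*(kQ)$ be the twisted Ringel–Hall algebra: the $\mathbb{Q}(v_q)$-vector space with basis $u_{[M]}$ indexed by the isomorphism classes of finite-dimensional $k$-representations $M$ of $Q$, with product $$u_{[M]}*u_{[N]}=v_q^{\langle\underline{\dim}M,\underline{\dim}N\rangle}\sum_{[L]}g^L_{MN}\,u_{[L]},$$ where $\langle-,-\rangle$ is the Euler form of $Q$ and $g^L_{MN}$ is the number of subrepresentations $W\subseteq L$ with $W\cong N$ and $L/W\cong M$. Let $\mathcal{R}_{\rm h}$ be the category of homogeneous regular representations, i.e. of finite direct sums of indecomposables in homogeneous tubes. A homogeneous tube $z$ has degree $d$ if its regular simple representation has dimension vector $d\delta$; let $M((n),z)$ denote the indecomposable representation of regular length $n$ in $z$. For $m\ge 0$ put $$H_m=\sum_{[M],\ M\in\mathcal{R}_{\rm h},\ \underline{\dim}M=m\delta}v_q^{-\dim M}u_{[M]},$$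 and $H_m=0$ for $m<0$. These elements commute with each other. For a partition $\lambda=(\lambda_1\ge\dots\ge\lambda_s)$ put $S_\lambda=\det(H_{\lambda_a-a+b})_{1\le a,b\le s}$, and let $B_\lambda^{[M]}$ be the coefficient of $u_{[M]}$ in $S_\lambda$. Let $\lambda$ and $\mu=(\mu_1\ge\dots\ge\mu_l)$ be partitions with $|\lambda|=|\mu|$, let $\underline z=(z_1,\dots,z_l)$ be pairwise different homogeneous tubes of degree $1$, and let $M(\mu,\underline z)=M((\mu_1),z_1)\oplus\dots\oplus M((\mu_l),z_l)$. Then $$B_\lambda^{[M(\mu,\underline z)]}=v_q^{-|\lambda||\delta|}K_{\mu\lambda},$$ where $K_{\mu\lambda}$ is the Kostka number, the number of semistandard Young tableaux of shape $\lambda$ and content $\mu$. -/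

import Mathlib

namespace QuiverHall

open scoped Classical

noncomputable section

universe u v w

/-! ## Quivers: Euler form, affine type, minimal imaginary root -/

section Quivers

variable (I : Type w) [Quiver.{v} I] [Fintype I] [∀ i j : I, Fintype (i ⟶ j)]

/-- The Euler form `⟨a, b⟩ = ∑ i, a i * b i - ∑ (h : i ⟶ j), a i * b j` on `ℤ I`. -/
def eulerForm (a b : I → ℤ) : ℤ :=
  ∑ i, a i * b i - ∑ i, ∑ j, ∑ _h : i ⟶ j, a i * b j

/-- The quiver has no oriented cycle (in particular no loop). -/
def IsAcyclic (I : Type w) [Quiver.{v} I] : Prop :=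
  ∀ (i : I) (p : Quiver.Path i i), p.length = 0

/-- The quiver is of affine type: its underlying graph is connected and its symmetric
generalized Cartan matrix is positive semidefinite but not positive definite. -/
structure IsAffine : Prop where
  connected : Subsingleton (Quiver.WeaklyConnectedComponent I)
  semidefinite : ∀ a : I → ℤ, 0 ≤ eulerForm I a a
  isotropic : ∃ a : I → ℤ, a ≠ 0 ∧ eulerForm I a a = 0

/-- `δ` is the minimal positive imaginary root, that is, the least nonzero element of `ℕ I`
with `(δ, δ) = 2 ⟨δ, δ⟩ = 0`. -/
def IsMinimalImaginaryRoot (δ : I → ℕ) : Prop :=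
  IsLeast {a : I → ℕ | a ≠ 0 ∧ eulerForm I (fun i => (a i : ℤ)) (fun i => (a i : ℤ)) = 0} δ

end Quivers

/-! ## Finite-dimensional representations -/

section Representations

variable (k : Type u) [Field k] (I : Type w) [Quiver.{v} I]

/-- A finite-dimensional representation of the quiver `I` over the field `k`. -/
structure Rep where
  V : I → Type u
  [addCommGroup : ∀ i, AddCommGroup (V i)]
  [module : ∀ i, Module k (V i)]
  [finite : ∀ i, Module.Finite k (V i)]
  map : ∀ {i j : I}, (i ⟶ j) → V i →ₗ[k] V j

attribute [instance] Rep.addCommGroup Rep.module Rep.finite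

variable {k I}

namespace Rep

/-- Morphisms of representations. -/
structure Hom (M N : Rep k I) where
  app : ∀ i, M.V i →ₗ[k] N.V i
  comm : ∀ {i j : I} (h : i ⟶ j) (x : M.V i), app j (M.map h x) = N.map h (app i x)

/-- Isomorphisms of representations. -/
structure Iso (M N : Rep k I) where
  app : ∀ i, M.V i ≃ₗ[k] N.V i
  comm : ∀ {i j : I} (h : i ⟶ j) (x : M.V i), app j (M.map h x) = N.map h (app i x)

/-- The dimension vector. -/
def dimVec (M : Rep k I) : I → ℕ := fun i => Module.finrank k (M.V i)

/-- The zero representation. -/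
def zero : Rep k I where
  V _ := PUnit
  map _ := 0

/-- The direct sum of a finite family of representations. -/
def directSum {n : ℕ} (N : Fin n → Rep k I) : Rep k I where
  V i := ∀ a, (N a).V i
  map h := LinearMap.pi fun a => (N a).map h ∘ₗ LinearMap.proj a

/-- A subrepresentation. -/
structure Sub (M : Rep k I) where
  carrier : ∀ i, Submodule k (M.V i)
  stable : ∀ {i j : I} (h : i ⟶ j) (x : M.V i), x ∈ carrier i → M.map h x ∈ carrier j

/-- A subrepresentation as a representation in its own right. -/
def Sub.toRep {M : Rep k I} (W : Sub M) : Rep k I where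
  V i := W.carrier i
  map h := (M.map h).restrict (W.stable h)

/-- The quotient of a representation by a subrepresentation. -/
def Sub.quotient {M : Rep k I} (W : Sub M) : Rep k I where
  V i := M.V i ⧸ W.carrier i
  map {i j} h := Submodule.mapQ (W.carrier i) (W.carrier j) (M.map h) (W.stable h)

/-- A nonzero representation that is not a direct sum of two nonzero subrepresentations. -/
def Indecomposable (M : Rep k I) : Prop :=
  (∃ i, Nontrivial (M.V i)) ∧
    ∀ W W' : Sub M, (∀ i, IsCompl (W.carrier i) (W'.carrier i)) →
      (∀ i, W.carrier i = ⊥) ∨ (∀ i, W'.carrier i = ⊥)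

/-- A split epimorphism. -/
def Hom.IsRetraction {M N : Rep k I} (g : Hom M N) : Prop :=
  ∃ s : Hom N M, ∀ i x, g.app i (s.app i x) = x

/-- A split monomorphism. -/
def Hom.IsSection {M N : Rep k I} (f : Hom M N) : Prop :=
  ∃ r : Hom N M, ∀ i x, r.app i (f.app i x) = x

/-- `0 ⟶ N ⟶ F ⟶ M ⟶ 0` is an almost split (Auslander--Reiten) sequence. -/
structure IsAlmostSplit {N F M : Rep k I} (f : Hom N F) (g : Hom F M) : Prop where
  injective : ∀ i, Function.Injective (f.app i)
  surjective : ∀ i, Function.Surjective (g.app i)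
  exact : ∀ i, Function.Exact (f.app i) (g.app i)
  not_section : ¬ f.IsSection
  not_retraction : ¬ g.IsRetraction
  left_almost_split : ∀ (X : Rep k I) (h : Hom N X), ¬ h.IsSection →
    ∃ h' : Hom F X, ∀ i x, h'.app i (f.app i x) = h.app i x
  right_almost_split : ∀ (X : Rep k I) (h : Hom X M), ¬ h.IsRetraction →
    ∃ h' : Hom X F, ∀ i x, g.app i (h'.app i x) = h.app i x

/-- `M` is fixed by the Auslander--Reiten translation, `τ M ≅ M`: there is an almost split
sequence starting and ending in `M`. -/
def IsTauInvariant (M : Rep k I) : Prop :=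
  ∃ (F : Rep k I) (f : Hom M F) (g : Hom F M), IsAlmostSplit f g

end Rep

variable (k I)

/-- Isomorphism of representations as an equivalence relation. -/
instance isoSetoid : Setoid (Rep k I) where
  r M N := Nonempty (Rep.Iso M N)
  iseqv :=
    { refl := fun _ => ⟨⟨fun _ => LinearEquiv.refl k _, fun _ _ => rfl⟩⟩
      symm := fun ⟨e⟩ => ⟨⟨fun i => (e.app i).symm, fun {i j} h x => by
        rw [LinearEquiv.symm_apply_eq, e.comm, LinearEquiv.apply_symm_apply]⟩⟩
      trans := fun ⟨e⟩ ⟨f⟩ => ⟨⟨fun i => (e.app i).trans (f.app i), fun {i j} h x => by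
        simp [e.comm, f.comm]⟩⟩ }

/-- Isomorphism classes of finite-dimensional representations. -/
def IsoClass := Quotient (isoSetoid k I)

variable {k I}

/-- The isomorphism class `[M]`. -/
def isoClass (M : Rep k I) : IsoClass k I := Quotient.mk (isoSetoid k I) M

/-- A representative of an isomorphism class. -/
def IsoClass.rep (X : IsoClass k I) : Rep k I := Quotient.out X

theorem IsoClass.isoClass_rep (X : IsoClass k I) : isoClass X.rep = X := Quotient.out_eq X

theorem isoClass_eq_iff {M N : Rep k I} : isoClass M = isoClass N ↔ Nonempty (Rep.Iso M N) :=
  Quotient.eq (r := isoSetoid k I)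

theorem Rep.Iso.dimVec_eq {M N : Rep k I} (e : Rep.Iso M N) : M.dimVec = N.dimVec :=
  funext fun i => (e.app i).finrank_eq

/-- The dimension vector of an isomorphism class. -/
def IsoClass.dimVec (X : IsoClass k I) : I → ℕ :=
  Quotient.lift (s := isoSetoid k I) Rep.dimVec (fun _ _ ⟨e⟩ => e.dimVec_eq) X

theorem dimVec_isoClass (M : Rep k I) : (isoClass M).dimVec = M.dimVec := rfl

/-- The representation on the coordinate spaces given by a family of linear maps. -/
def coordRep [Fintype k] (d : I → ℕ)
    (A : ∀ p : (Σ i j : I, i ⟶ j), (Fin (d p.1) → k) →ₗ[k] (Fin (d p.2.1) → k)) : Rep k I where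
  V i := Fin (d i) → k
  map {i j} h := A ⟨i, j, h⟩

/-- Over a finite field there are finitely many isomorphism classes of given dimension. -/
theorem finite_dimVec_eq [Fintype k] [Fintype I] [∀ i j : I, Fintype (i ⟶ j)] (d : I → ℕ) :
    {X : IsoClass k I | X.dimVec = d}.Finite := by
  have (p : Σ i j : I, i ⟶ j) : Finite ((Fin (d p.1) → k) →ₗ[k] (Fin (d p.2.1) → k)) :=
    Finite.of_injective (fun f => (f : (Fin (d p.1) → k) → (Fin (d p.2.1) → k)))
      DFunLike.coe_injective
  refine (Set.finite_range fun A => isoClass (coordRep (k := k) (I := I) d A)).subset ?_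
  intro X hX
  obtain ⟨M, rfl⟩ : ∃ M, isoClass M = X := ⟨X.rep, X.isoClass_rep⟩
  have hd : ∀ i, Module.finrank k (M.V i) = Module.finrank k (Fin (d i) → k) := fun i => by
    rw [Module.finrank_fin_fun]; exact congrFun hX i
  let e : ∀ i, M.V i ≃ₗ[k] (Fin (d i) → k) := fun i => LinearEquiv.ofFinrankEq _ _ (hd i)
  refine ⟨fun p => (e p.2.1).toLinearMap ∘ₗ M.map p.2.2 ∘ₗ (e p.1).symm.toLinearMap, ?_⟩
  exact isoClass_eq_iff.2 ⟨⟨fun i => (e i).symm, fun {i j} h x => by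
    change (e j).symm ((e j) (M.map h ((e i).symm x))) = _
    rw [LinearEquiv.symm_apply_apply]
    rfl⟩⟩

theorem Rep.Sub.dimVec_quotient_add {M : Rep k I} (W : Rep.Sub M) :
    W.quotient.dimVec + W.toRep.dimVec = M.dimVec :=
  funext fun i => (W.carrier i).finrank_quotient_add_finrank

end Representations

/-! ## The Ringel--Hall algebra -/

section HallAlgebra

variable (k : Type u) [Field k] [Fintype k]
  (I : Type w) [Quiver.{v} I] [Fintype I] [∀ i j : I, Fintype (i ⟶ j)]

/-- The field `ℚ(v)`, where `v = √q` and `q` is the number of elements of `k`. -/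
abbrev QSqrt : Type :=
  IntermediateField.adjoin ℚ {((Real.sqrt (Fintype.card k) : ℝ) : ℂ)}

/-- The element `v = √q` of `ℚ(v)`. -/
def vq : QSqrt k :=
  ⟨((Real.sqrt (Fintype.card k) : ℝ) : ℂ),
    IntermediateField.mem_adjoin_simple_self ℚ _⟩

variable {k I}

/-- The Hall number `g^L_{M N}`: the number of subrepresentations `W` of (a representative of)
`L` with `W ≅ N` and `L / W ≅ M`. -/
def hallNumber (L M N : IsoClass k I) : ℕ :=
  Nat.card {W : Rep.Sub L.rep // isoClass W.toRep = N ∧ isoClass W.quotient = M}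

theorem finite_hallNumber (M N : IsoClass k I) : {L | hallNumber L M N ≠ 0}.Finite := by
  refine (finite_dimVec_eq (M.dimVec + N.dimVec)).subset ?_
  intro L hL
  have : Nonempty {W : Rep.Sub L.rep // isoClass W.toRep = N ∧ isoClass W.quotient = M} := by
    by_contra h
    rw [not_nonempty_iff] at h
    exact hL Nat.card_of_isEmpty
  obtain ⟨W, rfl, rfl⟩ := this
  have h := W.dimVec_quotient_add
  rw [← dimVec_isoClass L.rep, L.isoClass_rep] at h
  exact h.symm

variable (k I)

/-- The Ringel--Hall algebra: the `ℚ(v)`-vector space with basis the isomorphism classes. -/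
def HallAlgebra : Type _ := IsoClass k I →₀ QSqrt k

instance : AddCommGroup (HallAlgebra k I) :=
  inferInstanceAs (AddCommGroup (IsoClass k I →₀ QSqrt k))

instance : Module (QSqrt k) (HallAlgebra k I) :=
  inferInstanceAs (Module (QSqrt k) (IsoClass k I →₀ QSqrt k))

variable {k I}

/-- The coefficient of the basis element `u_X`. -/
def HallAlgebra.coeff (x : HallAlgebra k I) (X : IsoClass k I) : QSqrt k :=
  (show IsoClass k I →₀ QSqrt k from x) X

/-- The basis element `u_X`. -/
def HallAlgebra.u (X : IsoClass k I) : HallAlgebra k I :=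
  (Finsupp.single X 1 : IsoClass k I →₀ QSqrt k)

/-- The twisted product of basis elements,
`u_M * u_N = v ^ ⟨dim M, dim N⟩ ∑ L, g^L_{M N} u_L`. -/
def HallAlgebra.basisMul (M N : IsoClass k I) : HallAlgebra k I :=
  vq k ^ eulerForm I (fun i => (M.dimVec i : ℤ)) (fun i => (N.dimVec i : ℤ)) •
    (Finsupp.ofSupportFinite (fun L => (hallNumber L M N : QSqrt k))
      ((finite_hallNumber M N).subset fun L hL h => hL (by simp [h])) :
      IsoClass k I →₀ QSqrt k)

/-- The bilinear extension of the product of basis elements. -/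
instance : Mul (HallAlgebra k I) where
  mul x y := (show IsoClass k I →₀ QSqrt k from x).sum fun M a =>
    (show IsoClass k I →₀ QSqrt k from y).sum fun N b =>
      (a * b) • HallAlgebra.basisMul M N

/-- The unit is the basis element of the zero representation. -/
instance : One (HallAlgebra k I) where
  one := HallAlgebra.u (isoClass Rep.zero)

end HallAlgebra

/-! ## Homogeneous tubes -/

section Tubes

variable {k : Type u} [Field k]
  {I : Type w} [Quiver.{v} I] [Fintype I] [∀ i j : I, Fintype (i ⟶ j)] (δ : I → ℕ)

/-- The defect `⟨δ, dim M⟩`. For `δ` the minimal imaginary root of an affine quiver it is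
negative, zero, positive on the indecomposable representations that are preprojective,
regular, preinjective, respectively. -/
def Rep.defect (M : Rep k I) : ℤ :=
  eulerForm I (fun i => (δ i : ℤ)) (fun i => (M.dimVec i : ℤ))

/-- `M` is regular: it has defect zero and no subrepresentation of positive defect. As there
are no nonzero maps from preinjective to regular or preprojective representations, and none
from regular to preprojective ones, this says that `M` is a direct sum of indecomposable
representations of defect zero. -/
def Rep.IsRegular (M : Rep k I) : Prop :=
  M.defect δ = 0 ∧ ∀ W : Rep.Sub M, W.toRep.defect δ ≤ 0

/-- `E` is regular simple: a nonzero regular representation without regular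
subrepresentations other than `0` and `E`. -/
def Rep.IsRegularSimple (E : Rep k I) : Prop :=
  E.IsRegular δ ∧ (∃ i, Nontrivial (E.V i)) ∧
    ∀ W : Rep.Sub E, W.toRep.IsRegular δ →
      (∀ i, W.carrier i = ⊥) ∨ (∀ i, W.carrier i = ⊤)

variable (k)

/-- A homogeneous tube, given by the isomorphism class of the regular simple representation
`E ≅ τ E` at its mouth. -/
@[ext]
structure HomogeneousTube where
  mouth : IsoClass k I
  exists_rep : ∃ E : Rep k I, isoClass E = mouth ∧ E.IsRegularSimple δ ∧ E.IsTauInvariant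

variable {k}

/-- `M` has a filtration of length `n` all of whose factors are in the class `X`. -/
def Rep.HasFiltration (X : IsoClass k I) : ℕ → Rep k I → Prop
  | 0, M => ∀ i, Subsingleton (M.V i)
  | n + 1, M => ∃ W : Rep.Sub M, Rep.HasFiltration X n W.toRep ∧ isoClass W.quotient = X

variable {δ}

/-- `M ≅ M((n), z)`: the representation `M` is indecomposable and lies in the homogeneous
tube `z`, with `n` regular composition factors (all isomorphic to the mouth of `z`). -/
def HomogeneousTube.IsIndecomposableOfLength (z : HomogeneousTube k δ) (n : ℕ)
    (M : Rep k I) : Prop :=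
  M.Indecomposable ∧ M.HasFiltration z.mouth n

/-- The degree of the tube `z` is `d`: the regular simple representation of `z` has dimension
vector `d δ`. -/
def HomogeneousTube.HasDegree (z : HomogeneousTube k δ) (d : ℕ) : Prop :=
  z.mouth.dimVec = d • δ

variable (δ)

/-- `X` is the class of a homogeneous regular representation, that is, of a (possibly empty)
finite direct sum of indecomposable representations in homogeneous tubes. -/
def IsoClass.IsHomogeneousRegular (X : IsoClass k I) : Prop :=
  ∃ (n : ℕ) (N : Fin n → Rep k I),
    (∀ a, ∃ (z : HomogeneousTube k δ) (l : ℕ), z.IsIndecomposableOfLength l (N a)) ∧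
      isoClass (Rep.directSum N) = X

end Tubes

/-! ## The elements `H_m` and `S_λ`, Kostka numbers -/

section Elements

variable (k : Type u) [Field k] [Fintype k]
  {I : Type w} [Quiver.{v} I] [Fintype I] [∀ i j : I, Fintype (i ⟶ j)] (δ : I → ℕ)

/-- `H_m = ∑ v ^ (- dim M) u_M`, summed over the classes of homogeneous regular
representations `M` with dimension vector `m δ`. -/
def hallH (m : ℕ) : HallAlgebra k I :=
  (Finsupp.ofSupportFinite
    (fun X : IsoClass k I =>
      if X.IsHomogeneousRegular δ ∧ X.dimVec = m • δ then
        vq k ^ (-((∑ i, X.dimVec i : ℕ) : ℤ)) else 0)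
    ((finite_dimVec_eq (m • δ)).subset fun X hX => by
      by_contra h
      exact hX (if_neg fun h' => h h'.2)) : IsoClass k I →₀ QSqrt k)

/-- `H_m` for an integer index, with `H_m = 0` for `m < 0`. -/
def hallHInt (m : ℤ) : HallAlgebra k I :=
  if 0 ≤ m then hallH k δ m.toNat else 0

/-- `S_λ = det (H_{λ_a - a + b})`, where `a, b` run over the rows of `λ`. The determinant is
written out by the Leibniz formula, each product being taken in the order of the rows (the
elements `H_m` commute with each other, so the order is immaterial). -/
def hallS (lam : YoungDiagram) : HallAlgebra k I :=
  ∑ σ : Equiv.Perm (Fin (lam.colLen 0)),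
    ((Equiv.Perm.sign σ : ℤˣ) : ℤ) •
      (List.ofFn fun a : Fin (lam.colLen 0) =>
        hallHInt k δ ((lam.rowLen a : ℤ) - (a : ℤ) + (σ a : ℤ))).prod

/-- The Kostka number `K_{μ λ}`: the number of semistandard Young tableaux with content `μ`
(the entry `i` occurs `μ_i` times) and shape `λ`. Rows and entries are numbered from `0`. -/
def kostka (mu lam : YoungDiagram) : ℕ :=
  Nat.card {T : SemistandardYoungTableau lam //
    ∀ i, (lam.cells.filter fun c => T c.1 c.2 = i).card = mu.rowLen i}

end Elements

end

end QuiverHall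

/-!
The indecomposable summands `M((μ_a), z_a)` lie in different tubes of degree one, and the regular
subrepresentations of their direct sum `M` are completely described by their lengths.

Let `E` be the mouth of such a tube, so that `dim E = δ` and `⟨dim E, dim E⟩ = 0`. The regular
subrepresentations of a regular representation are those of defect zero, and they form a modular
lattice. If all regular composition factors of `N` are isomorphic to `E` and `N` is indecomposable,
this lattice is a chain (`Rep.IsPure.isUniserial`). The homological input is a dimension count: for
a surjection `X ⟶ Q` whose kernel is orthogonal to `E` for the Euler form,
`dim Hom(E, Q) ≤ dim Hom(E, X)` (`Rep.finrank_homSpace_le_of_surjective`), and dually. It yields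
that a regular subrepresentation `a` covered by `s` has a second cover as soon as `s` has two
(`Rep.IsPure.exists_regCov_ne`, and its dual), and a finite modular lattice with these properties
and without nontrivial complements is a chain (`isChain_of_covBy_of_isCompl`). As there are no
isomorphisms between mouths of different tubes, a regular subrepresentation of `M` is the sum of its
intersections with the summands (`Rep.Sub.eq_prod_of_isReg`). Hence the regular subrepresentations
of `M` correspond to the vectors `β ≤ μ` of lengths, the subrepresentation and the quotient being
again of the same kind, of types `β` and `μ - β` (`Rep.IsOfType.exists_equiv`).

The Euler form vanishes on multiples of `δ`, so the twist of the product plays no role, and the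
coefficient of `M` in a product of elements `H_m` is, up to a power of `v`, the number of chains of
vectors of lengths with prescribed differences of total degree. This is the coefficient of `x ^ μ`
in the product of the complete homogeneous symmetric polynomials (`coeff_prod_hallHInt`).

It remains to see that the coefficients of the Jacobi--Trudi determinant count semistandard tableaux
(`coeff_jacobiTrudi`). Both sides satisfy the same branching rule when the largest entry, or the
last variable, is split off (`jacobiTrudi_succ`, `card_tableaux_succ`).
-/

namespace QuiverHall

universe u v w

/-! ### Homomorphisms and subrepresentations -/

section Subrepresentations

variable {k : Type u} [Field k] {I : Type w} [Quiver.{v} I]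

namespace Rep

/-- The identity of a representation. -/
def Hom.id (A : Rep k I) : Hom A A := ⟨fun _ => LinearMap.id, fun _ _ => rfl⟩

/-- The composite of two homomorphisms of representations. -/
def Hom.comp {A B C : Rep k I} (g : Hom B C) (f : Hom A B) : Hom A C :=
  ⟨fun i => g.app i ∘ₗ f.app i, fun h x => by simp [f.comm, g.comm]⟩

@[simp] theorem Hom.comp_app {A B C : Rep k I} (g : Hom B C) (f : Hom A B) (i : I) (x : A.V i) :
    (g.comp f).app i x = g.app i (f.app i x) := rfl

/-- The homomorphism underlying an isomorphism. -/
def Iso.hom {A B : Rep k I} (e : Iso A B) : Hom A B := ⟨fun i => (e.app i).toLinearMap, e.comm⟩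

@[simp] theorem Iso.hom_app {A B : Rep k I} (e : Iso A B) (i : I) (x : A.V i) :
    e.hom.app i x = e.app i x := rfl

/-- A bijective homomorphism is an isomorphism. -/
noncomputable def Iso.ofBijective {A B : Rep k I} (f : Hom A B)
    (hf : ∀ i, Function.Bijective (f.app i)) : Iso A B :=
  ⟨fun i => LinearEquiv.ofBijective (f.app i) (hf i), fun h x => f.comm h x⟩

theorem iso_symm {A B : Rep k I} (h : Nonempty (Iso A B)) : Nonempty (Iso B A) :=
  (isoSetoid k I).symm h

theorem iso_trans {A B C : Rep k I} (h : Nonempty (Iso A B)) (h' : Nonempty (Iso B C)) :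
    Nonempty (Iso A C) :=
  (isoSetoid k I).trans h h'

namespace Sub

variable {M : Rep k I}

theorem carrier_injective : Function.Injective (Sub.carrier : Sub M → _) := by
  rintro ⟨c, h⟩ ⟨c', h'⟩ (rfl : c = c')
  rfl

instance : PartialOrder (Sub M) := PartialOrder.lift Sub.carrier carrier_injective

theorem ext {W W' : Sub M} (h : ∀ i x, x ∈ W.carrier i ↔ x ∈ W'.carrier i) : W = W' :=
  le_antisymm (fun i x => (h i x).1) (fun i x => (h i x).2)

instance : Lattice (Sub M) where
  sup W W' := ⟨fun i => W.carrier i ⊔ W'.carrier i, fun {i j} h x hx => by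
    obtain ⟨y, hy, z, hz, rfl⟩ := Submodule.mem_sup.1 hx
    rw [map_add]
    exact Submodule.add_mem_sup (W.stable h y hy) (W'.stable h z hz)⟩
  inf W W' := ⟨fun i => W.carrier i ⊓ W'.carrier i, fun {i j} h x hx =>
    ⟨W.stable h x hx.1, W'.stable h x hx.2⟩⟩
  le_sup_left _ _ := fun _ => le_sup_left
  le_sup_right _ _ := fun _ => le_sup_right
  sup_le _ _ _ h h' := fun i => sup_le (h i) (h' i)
  inf_le_left _ _ := fun _ => inf_le_left
  inf_le_right _ _ := fun _ => inf_le_right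
  le_inf _ _ _ h h' := fun i => le_inf (h i) (h' i)

instance : BoundedOrder (Sub M) where
  top := ⟨fun _ => ⊤, fun _ _ _ => trivial⟩
  le_top _ := fun _ => le_top
  bot := ⟨fun _ => ⊥, fun h x hx => by rw [(Submodule.mem_bot k).1 hx, map_zero]; exact zero_mem _⟩
  bot_le _ := fun _ => bot_le

@[simp] theorem inf_carrier (W W' : Sub M) (i : I) :
    (W ⊓ W').carrier i = W.carrier i ⊓ W'.carrier i := rfl

@[simp] theorem top_carrier (i : I) : (⊤ : Sub M).carrier i = ⊤ := rfl

@[simp] theorem bot_carrier (i : I) : (⊥ : Sub M).carrier i = ⊥ := rfl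

theorem eq_bot_iff' {W : Sub M} : W = ⊥ ↔ ∀ i, W.carrier i = ⊥ :=
  ⟨fun h i => by rw [h]; rfl, fun h => carrier_injective (funext h)⟩

theorem eq_top_iff' {W : Sub M} : W = ⊤ ↔ ∀ i, W.carrier i = ⊤ :=
  ⟨fun h i => by rw [h]; rfl, fun h => carrier_injective (funext h)⟩

instance : IsModularLattice (Sub M) where
  sup_inf_le_assoc_of_le W' _ h := fun i => IsModularLattice.sup_inf_le_assoc_of_le
    (W'.carrier i) (h i)

instance [Finite k] [Finite I] : Finite (Sub M) := by
  have (i : I) : Finite (M.V i) := Module.finite_of_finite k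
  have (i : I) : Finite (Submodule k (M.V i)) := Finite.of_injective _ SetLike.coe_injective
  exact Finite.of_injective _ carrier_injective

/-- The inclusion of a subrepresentation. -/
def incl (W : Sub M) : Hom W.toRep M := ⟨fun i => (W.carrier i).subtype, fun _ _ => rfl⟩

/-- The projection onto the quotient by a subrepresentation. -/
def mkQ (W : Sub M) : Hom M W.quotient := ⟨fun i => (W.carrier i).mkQ, fun _ _ => rfl⟩

theorem incl_injective (W : Sub M) (i : I) : Function.Injective (W.incl.app i) :=
  Subtype.val_injective

theorem mkQ_surjective (W : Sub M) (i : I) : Function.Surjective (W.mkQ.app i) :=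
  Submodule.mkQ_surjective _

theorem mkQ_eq_zero (W : Sub M) {i : I} {x : M.V i} : W.mkQ.app i x = 0 ↔ x ∈ W.carrier i :=
  Submodule.Quotient.mk_eq_zero _

@[simp] theorem incl_mem (W : Sub M) {i : I} (x : W.toRep.V i) : W.incl.app i x ∈ W.carrier i :=
  Subtype.property (p := fun y => y ∈ W.carrier i) x

theorem exists_incl_eq (W : Sub M) {i : I} {x : M.V i} (hx : x ∈ W.carrier i) :
    ∃ y : W.toRep.V i, W.incl.app i y = x := ⟨⟨x, hx⟩, rfl⟩

variable {A B : Rep k I}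

/-- The image of a subrepresentation. -/
def map (f : Hom A B) (W : Sub A) : Sub B :=
  ⟨fun i => (W.carrier i).map (f.app i), fun {i j} h x hx => by
    obtain ⟨y, hy, rfl⟩ := hx
    exact ⟨A.map h y, W.stable h y hy, f.comm h y⟩⟩

/-- The preimage of a subrepresentation. -/
def comap (f : Hom A B) (W : Sub B) : Sub A :=
  ⟨fun i => (W.carrier i).comap (f.app i), fun {i j} h x hx => by
    rw [Submodule.mem_comap, f.comm]
    exact W.stable h _ hx⟩

@[simp] theorem mem_comap {f : Hom A B} {W : Sub B} {i : I} {x : A.V i} :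
    x ∈ (W.comap f).carrier i ↔ f.app i x ∈ W.carrier i := Iff.rfl

theorem map_le_iff_le_comap {f : Hom A B} {W : Sub A} {W' : Sub B} :
    W.map f ≤ W' ↔ W ≤ W'.comap f :=
  forall_congr' fun _ => Submodule.map_le_iff_le_comap

theorem map_mono (f : Hom A B) {W W' : Sub A} (h : W ≤ W') : W.map f ≤ W'.map f :=
  fun i => Submodule.map_mono (h i)

theorem comap_mono (f : Hom A B) {W W' : Sub B} (h : W ≤ W') : W.comap f ≤ W'.comap f :=
  fun i => Submodule.comap_mono (h i)

theorem map_comap_of_surjective {f : Hom A B} (hf : ∀ i, Function.Surjective (f.app i))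
    (W : Sub B) : (W.comap f).map f = W :=
  carrier_injective (funext fun i => Submodule.map_comap_eq_of_surjective (hf i) _)

theorem comap_map_of_injective {f : Hom A B} (hf : ∀ i, Function.Injective (f.app i))
    (W : Sub A) : (W.map f).comap f = W :=
  carrier_injective (funext fun i => Submodule.comap_map_eq_of_injective (hf i) _)

theorem map_comap_incl (W V : Sub M) : (V.comap W.incl).map W.incl = V ⊓ W := by
  refine ext fun i x => ⟨?_, fun hx => ⟨⟨x, hx.2⟩, hx.1, rfl⟩⟩
  rintro ⟨y, hy, rfl⟩
  exact ⟨hy, y.2⟩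

theorem le_comap_mkQ (W : Sub M) (V : Sub W.quotient) : W ≤ V.comap W.mkQ := fun i x hx => by
  rw [mem_comap, W.mkQ_eq_zero.2 hx]
  exact zero_mem _

theorem comap_map_mkQ (W V : Sub M) (h : W ≤ V) : (V.map W.mkQ).comap W.mkQ = V := by
  refine ext fun i x => ⟨?_, fun hx => ⟨x, hx, rfl⟩⟩
  rintro ⟨y, hy, hyx⟩
  have : x - y ∈ W.carrier i := by
    rw [← W.mkQ_eq_zero, map_sub, hyx, sub_self]
  simpa using add_mem (h i this) hy

theorem comap_bot_mkQ (W : Sub M) : (⊥ : Sub W.quotient).comap W.mkQ = W :=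
  ext fun _ _ => W.mkQ_eq_zero

/-- The subquotient `W / (W ∩ Y)`. -/
abbrev subquot (Y W : Sub M) : Rep k I := (Y.comap W.incl).quotient

end Sub

/-- A homomorphism factors through a surjective one with smaller kernel. -/
theorem Hom.exists_comp_eq_of_surjective {A B E : Rep k I} (g : Hom A E) (f : Hom A B)
    (hg : ∀ i, Function.Surjective (g.app i)) (h : ∀ i x, g.app i x = 0 → f.app i x = 0) :
    ∃ φ : Hom E B, ∀ i x, φ.app i (g.app i x) = f.app i x := by
  have key (i : I) : ∃ φ : E.V i →ₗ[k] B.V i, ∀ x, φ (g.app i x) = f.app i x := by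
    refine ⟨(LinearMap.ker (g.app i)).liftQ (f.app i) (fun x hx => h i x hx) ∘ₗ
      ((g.app i).quotKerEquivOfSurjective (hg i)).symm.toLinearMap, fun x => ?_⟩
    have : ((g.app i).quotKerEquivOfSurjective (hg i)).symm (g.app i x) =
        Submodule.Quotient.mk x := by
      rw [LinearEquiv.symm_apply_eq]; rfl
    rw [LinearMap.comp_apply, LinearEquiv.coe_coe, this]
    rfl
  choose φ hφ using key
  refine ⟨⟨φ, fun {i j} a y => ?_⟩, hφ⟩
  obtain ⟨x, rfl⟩ := hg i y
  rw [← g.comm, hφ, hφ, f.comm]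

/-- A homomorphism factors through an injective one with larger image. -/
theorem Hom.exists_comp_eq_of_injective {A B E : Rep k I} (g : Hom E B) (f : Hom A B)
    (hg : ∀ i, Function.Injective (g.app i)) (h : ∀ i x, ∃ y, g.app i y = f.app i x) :
    ∃ φ : Hom A E, ∀ i x, g.app i (φ.app i x) = f.app i x := by
  have key (i : I) : ∃ φ : A.V i →ₗ[k] E.V i, ∀ x, g.app i (φ x) = f.app i x := by
    refine ⟨(LinearEquiv.ofInjective (g.app i) (hg i)).symm.toLinearMap ∘ₗ
      (f.app i).codRestrict (LinearMap.range (g.app i)) (fun x => h i x), fun x => ?_⟩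
    exact congrArg Subtype.val ((LinearEquiv.ofInjective (g.app i) (hg i)).apply_symm_apply
      ⟨f.app i x, h i x⟩)
  choose φ hφ using key
  refine ⟨⟨φ, fun {i j} a y => hg j ?_⟩, hφ⟩
  rw [hφ, g.comm, hφ, f.comm]

/-- The first isomorphism theorem. -/
theorem Sub.quotient_iso_of_surjective {A B : Rep k I} (K : Sub A) (g : Hom A B)
    (hg : ∀ i, Function.Surjective (g.app i)) (h : ∀ i x, g.app i x = 0 ↔ x ∈ K.carrier i) :
    Nonempty (Iso K.quotient B) := by
  obtain ⟨φ, hφ⟩ := Hom.exists_comp_eq_of_surjective K.mkQ g K.mkQ_surjective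
    (fun i x hx => (h i x).2 (K.mkQ_eq_zero.1 hx))
  refine ⟨Iso.ofBijective φ fun i => ⟨?_, fun y => ?_⟩⟩
  · refine (injective_iff_map_eq_zero _).2 fun y hy => ?_
    obtain ⟨x, rfl⟩ := K.mkQ_surjective i y
    rw [hφ] at hy
    exact K.mkQ_eq_zero.2 ((h i x).1 hy)
  · obtain ⟨x, rfl⟩ := hg i y
    exact ⟨_, hφ i x⟩

/-- A homomorphism `f` induces an isomorphism `W / Y ≅ W' / Y'` when `Y` is the part of `W` sent
into `Y'` and the image of `W` generates `W'` modulo `Y'`. This contains all three isomorphism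
theorems. -/
theorem Sub.subquot_iso {A B : Rep k I} (f : Hom A B) {Y W : Sub A} {Y' W' : Sub B}
    (hW : W ≤ W'.comap f) (hY : ∀ i x, x ∈ W.carrier i → (f.app i x ∈ Y'.carrier i ↔
      x ∈ Y.carrier i)) (hW' : W' ≤ W.map f ⊔ Y') :
    Nonempty (Iso (subquot Y W) (subquot Y' W')) := by
  obtain ⟨g, hg⟩ := Hom.exists_comp_eq_of_injective W'.incl (f.comp W.incl) W'.incl_injective
    (fun i x => W'.exists_incl_eq (hW i (W.incl_mem x)))
  refine Sub.quotient_iso_of_surjective _ ((Y'.comap W'.incl).mkQ.comp g) (fun i y => ?_)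
    fun i x => ?_
  · obtain ⟨y, rfl⟩ := Sub.mkQ_surjective _ i y
    obtain ⟨a, ⟨x, hx, rfl⟩, b, hb, hab⟩ := Submodule.mem_sup.1 (hW' i (W'.incl_mem y))
    obtain ⟨x, rfl⟩ := W.exists_incl_eq hx
    refine ⟨x, ?_⟩
    rw [Hom.comp_app, ← sub_eq_zero, ← map_sub, Sub.mkQ_eq_zero, Sub.mem_comap, map_sub, hg,
      ← hab, Hom.comp_app, sub_add_cancel_left]
    exact neg_mem hb
  · rw [Hom.comp_app, Sub.mkQ_eq_zero, Sub.mem_comap, Sub.mem_comap, hg]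
    exact hY i _ (W.incl_mem x)

theorem Sub.subquot_top_iso {M : Rep k I} (W : Sub M) :
    Nonempty (Iso (subquot W ⊤) W.quotient) :=
  Sub.quotient_iso_of_surjective _ (W.mkQ.comp (⊤ : Sub M).incl) (fun i y => by
    obtain ⟨x, rfl⟩ := W.mkQ_surjective i y
    exact ⟨⟨x, trivial⟩, rfl⟩) fun _ _ => W.mkQ_eq_zero

/-- An isomorphism `W / Y ≅ E` is given by a surjection `W ⟶ E` with kernel `Y`. -/
theorem Sub.exists_hom_of_subquot_iso {M E : Rep k I} {Y W : Sub M}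
    (h : Nonempty (Iso (subquot Y W) E)) : ∃ g : Hom W.toRep E,
      (∀ i, Function.Surjective (g.app i)) ∧
        ∀ i x, g.app i x = 0 ↔ W.incl.app i x ∈ Y.carrier i := by
  obtain ⟨e⟩ := h
  refine ⟨e.hom.comp (Y.comap W.incl).mkQ, fun i =>
    (e.app i).surjective.comp (Sub.mkQ_surjective _ i), fun i x => ?_⟩
  rw [Hom.comp_app, Iso.hom_app, LinearEquiv.map_eq_zero_iff, Sub.mkQ_eq_zero, Sub.mem_comap]

end Rep

end Subrepresentations

/-! ### The lattice of subrepresentations of defect zero -/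

section Regular

open Module

variable {k : Type u} [Field k] {I : Type w} [Quiver.{v} I]

namespace Rep

theorem Sub.dimVec_sup_add_inf {M : Rep k I} (W W' : Sub M) (i : I) :
    (W ⊔ W').toRep.dimVec i + (W ⊓ W').toRep.dimVec i = W.toRep.dimVec i + W'.toRep.dimVec i :=
  Submodule.finrank_sup_add_finrank_inf_eq (W.carrier i) (W'.carrier i)

theorem Sub.dimVec_map_add {A B : Rep k I} (f : Hom A B) (W : Sub A) (i : I) :
    (W.map f).toRep.dimVec i + (W ⊓ (⊥ : Sub B).comap f).toRep.dimVec i = W.toRep.dimVec i := by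
  have h := LinearMap.finrank_range_add_finrank_ker ((f.app i).domRestrict (W.carrier i))
  have h1 : LinearMap.range ((f.app i).domRestrict (W.carrier i)) =
      (W.carrier i).map (f.app i) := by
    rw [LinearMap.range_domRestrict]
  have h2 : (LinearMap.ker ((f.app i).domRestrict (W.carrier i))).map (W.carrier i).subtype =
      W.carrier i ⊓ (⊥ : Submodule k (B.V i)).comap (f.app i) := by
    ext x
    simp only [Submodule.mem_map, LinearMap.mem_ker, Submodule.mem_inf, Submodule.mem_comap,
      Submodule.mem_bot]
    exact ⟨fun ⟨y, hy, e⟩ => e ▸ ⟨y.2, hy⟩, fun hx => ⟨⟨x, hx.1⟩, hx.2, rfl⟩⟩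
  have h3 := (Submodule.equivMapOfInjective _ (W.carrier i).subtype_injective
    (LinearMap.ker ((f.app i).domRestrict (W.carrier i)))).finrank_eq
  rw [h1, h3, h2] at h
  exact h

theorem dimVec_top (M : Rep k I) : (⊤ : Sub M).toRep.dimVec = M.dimVec :=
  funext fun _ => finrank_top k _

theorem dimVec_bot (M : Rep k I) : (⊥ : Sub M).toRep.dimVec = 0 :=
  funext fun _ => finrank_bot k _

theorem Sub.eq_of_le_of_dimVec_eq {M : Rep k I} {W W' : Sub M} (h : W ≤ W')
    (hd : W.toRep.dimVec = W'.toRep.dimVec) : W = W' :=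
  Sub.carrier_injective (funext fun i => Submodule.eq_of_le_of_finrank_eq (h i) (congrFun hd i))

theorem Sub.dimVec_map_of_injective {A B : Rep k I} {f : Hom A B}
    (hf : ∀ i, Function.Injective (f.app i)) (W : Sub A) :
    (W.map f).toRep.dimVec = W.toRep.dimVec :=
  funext fun i => ((Submodule.equivMapOfInjective _ (hf i) (W.carrier i)).finrank_eq).symm

theorem Sub.dimVec_comap_mkQ {M : Rep k I} (W : Sub M) (V : Sub W.quotient) (i : I) :
    V.toRep.dimVec i + W.toRep.dimVec i = (V.comap W.mkQ).toRep.dimVec i := by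
  have := (V.comap W.mkQ).dimVec_map_add W.mkQ i
  rwa [Sub.map_comap_of_surjective W.mkQ_surjective, Sub.comap_bot_mkQ,
    inf_eq_right.2 (W.le_comap_mkQ V)] at this

variable [Fintype I] [∀ i j : I, Fintype (i ⟶ j)]

theorem _root_.QuiverHall.eulerForm_add_right (a b c : I → ℤ) :
    eulerForm I a (b + c) = eulerForm I a b + eulerForm I a c := by
  simp only [eulerForm, Pi.add_apply, mul_add, Finset.sum_add_distrib]
  ring

theorem _root_.QuiverHall.eulerForm_add_left (a b c : I → ℤ) :
    eulerForm I (a + b) c = eulerForm I a c + eulerForm I b c := by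
  simp only [eulerForm, Pi.add_apply, add_mul, Finset.sum_add_distrib]
  ring

theorem _root_.QuiverHall.eulerForm_smul_smul (m n : ℤ) (a b : I → ℤ) :
    eulerForm I (m • a) (n • b) = m * n * eulerForm I a b := by
  simp only [eulerForm, Pi.smul_apply, smul_eq_mul, mul_sub, Finset.mul_sum]
  congr 1
  · exact Finset.sum_congr rfl fun _ _ => by ring
  · exact Finset.sum_congr rfl fun _ _ => Finset.sum_congr rfl fun _ _ =>
      Finset.sum_congr rfl fun _ _ => by ring

variable (δ : I → ℕ)

theorem defect_add_eq {A B C D : Rep k I}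
    (h : ∀ i, A.dimVec i + B.dimVec i = C.dimVec i + D.dimVec i) :
    A.defect δ + B.defect δ = C.defect δ + D.defect δ := by
  simp only [defect, ← eulerForm_add_right]
  congr 1
  funext i
  simp only [Pi.add_apply]
  exact_mod_cast h i

theorem defect_congr {A B : Rep k I} (h : A.dimVec = B.dimVec) : A.defect δ = B.defect δ := by
  simp only [defect, h]

theorem defect_eq_zero_of_dimVec_eq_zero {A : Rep k I} (h : A.dimVec = 0) : A.defect δ = 0 := by
  simp [defect, h, eulerForm]

theorem defect_eq_add {A B C : Rep k I} (h : ∀ i, B.dimVec i + C.dimVec i = A.dimVec i) :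
    B.defect δ + C.defect δ = A.defect δ := by
  have := defect_add_eq δ (A := B) (B := C) (C := A) (D := (⊥ : Sub A).toRep)
    (fun i => by rw [h, dimVec_bot]; rfl)
  rw [this, defect_eq_zero_of_dimVec_eq_zero δ (dimVec_bot A), add_zero]

/-- A subrepresentation of defect zero. In a regular representation these are exactly the
regular subrepresentations. -/
def Sub.IsReg {M : Rep k I} (W : Sub M) : Prop := W.toRep.defect δ = 0

variable {δ}

theorem Sub.isReg_bot {M : Rep k I} : (⊥ : Sub M).IsReg δ :=
  defect_eq_zero_of_dimVec_eq_zero δ (dimVec_bot M)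

theorem IsRegular.isReg_top {M : Rep k I} (hM : M.IsRegular δ) : (⊤ : Sub M).IsReg δ := by
  rw [Sub.IsReg, defect_congr δ (dimVec_top M), hM.1]

/-- The defects of `W ⊔ W'` and `W ⊓ W'` add up to zero, and neither is positive. -/
theorem IsRegular.isReg_sup_and_inf {M : Rep k I} (hM : M.IsRegular δ) {W W' : Sub M}
    (h : W.IsReg δ) (h' : W'.IsReg δ) : (W ⊔ W').IsReg δ ∧ (W ⊓ W').IsReg δ := by
  have := defect_add_eq δ (W.dimVec_sup_add_inf W')
  have h1 := hM.2 (W ⊔ W')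
  have h2 := hM.2 (W ⊓ W')
  unfold Sub.IsReg at *
  constructor <;> linarith

theorem IsRegular.isReg_map_and_ker {A B : Rep k I} (hA : A.IsRegular δ) (hB : B.IsRegular δ)
    (f : Hom A B) {W : Sub A} (h : W.IsReg δ) :
    (W.map f).IsReg δ ∧ (W ⊓ (⊥ : Sub B).comap f).IsReg δ := by
  have := defect_eq_add δ (W.dimVec_map_add f)
  have h1 := hB.2 (W.map f)
  have h2 := hA.2 (W ⊓ (⊥ : Sub B).comap f)
  unfold Sub.IsReg at *
  constructor <;> linarith

theorem IsRegular.isReg_map {A B : Rep k I} (hA : A.IsRegular δ) (hB : B.IsRegular δ)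
    (f : Hom A B) {W : Sub A} (h : W.IsReg δ) : (W.map f).IsReg δ :=
  (hA.isReg_map_and_ker hB f h).1

theorem IsRegular.isReg_comap {A B : Rep k I} (hA : A.IsRegular δ) (hB : B.IsRegular δ)
    (f : Hom A B) {W : Sub B} (h : W.IsReg δ) : (W.comap f).IsReg δ := by
  have h1 := hA.isReg_map_and_ker hB f hA.isReg_top
  have h2 := (hB.isReg_sup_and_inf h1.1 h).2
  have h3 := defect_eq_add δ ((W.comap f).dimVec_map_add f)
  have e1 : (W.comap f).map f = (⊤ : Sub A).map f ⊓ W := by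
    refine Sub.ext fun i x => ⟨?_, ?_⟩
    · rintro ⟨y, hy, rfl⟩
      exact ⟨⟨y, trivial, rfl⟩, hy⟩
    · rintro ⟨⟨y, -, rfl⟩, hy⟩
      exact ⟨y, hy, rfl⟩
  have e2 : W.comap f ⊓ (⊥ : Sub B).comap f = ⊤ ⊓ (⊥ : Sub B).comap f := by
    rw [top_inf_eq, inf_eq_right]
    exact Sub.comap_mono f bot_le
  rw [e1, e2] at h3
  have h4 := h1.2
  unfold Sub.IsReg at *
  linarith

theorem IsRegular.toRep {M : Rep k I} (hM : M.IsRegular δ) {W : Sub M} (h : W.IsReg δ) :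
    W.toRep.IsRegular δ := by
  refine ⟨h, fun V => ?_⟩
  rw [← defect_congr δ (Sub.dimVec_map_of_injective W.incl_injective V)]
  exact hM.2 _

theorem IsRegular.quotient {M : Rep k I} (hM : M.IsRegular δ) {W : Sub M} (h : W.IsReg δ) :
    W.quotient.IsRegular δ := by
  unfold Sub.IsReg at h
  constructor
  · have := defect_eq_add δ (congrFun W.dimVec_quotient_add)
    rw [h, hM.1, add_zero] at this
    exact this
  · intro V
    have := defect_eq_add δ (W.dimVec_comap_mkQ V)
    rw [h, add_zero] at this
    rw [this]
    exact hM.2 _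

theorem IsRegular.of_iso {A B : Rep k I} (hA : A.IsRegular δ) (e : Nonempty (Iso A B)) :
    B.IsRegular δ := by
  obtain ⟨e⟩ := iso_symm e
  refine ⟨by rw [defect_congr δ e.dimVec_eq, hA.1], fun V => ?_⟩
  rw [← defect_congr δ (Sub.dimVec_map_of_injective (f := e.hom)
    (fun i => (e.app i).injective) V)]
  exact hA.2 _

/-- Regular representations are closed under extensions. -/
theorem IsRegular.of_sub_of_quotient {M : Rep k I} {W : Sub M} (h : W.toRep.IsRegular δ)
    (h' : W.quotient.IsRegular δ) : M.IsRegular δ := by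
  constructor
  · rw [← defect_eq_add δ (congrFun W.dimVec_quotient_add), h.1, h'.1, add_zero]
  · intro V
    rw [← defect_eq_add δ (V.dimVec_map_add W.mkQ), Sub.comap_bot_mkQ, ← Sub.map_comap_incl,
      defect_congr δ (Sub.dimVec_map_of_injective W.incl_injective _)]
    exact add_nonpos (h'.2 _) (h.2 _)

/-- `W` covers `Y` in the lattice of subrepresentations of defect zero. -/
structure Sub.RegCov (δ : I → ℕ) {M : Rep k I} (Y W : Sub M) : Prop where
  left : Y.IsReg δ
  right : W.IsReg δ
  lt : Y < W
  eq_or_eq : ∀ V : Sub M, V.IsReg δ → Y ≤ V → V ≤ W → V = Y ∨ V = W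

/-- A regular simple representation has exactly two subrepresentations of defect zero. -/
theorem IsRegularSimple.eq_bot_or_eq_top {E : Rep k I} (hE : E.IsRegularSimple δ) {W : Sub E}
    (h : W.IsReg δ) : W = ⊥ ∨ W = ⊤ := by
  rw [Sub.eq_bot_iff', Sub.eq_top_iff']
  exact hE.2.2 W (hE.1.toRep h)

theorem IsRegularSimple.of_iso {E E' : Rep k I} (hE : E.IsRegularSimple δ)
    (h : Nonempty (Iso E E')) : E'.IsRegularSimple δ := by
  have hE' := hE.1.of_iso h
  obtain ⟨e⟩ := h
  refine ⟨hE', ?_, fun W hW => ?_⟩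
  · obtain ⟨i, hi⟩ := hE.2.1
    exact ⟨i, (e.app i).symm.toEquiv.nontrivial⟩
  · rw [← Sub.eq_bot_iff', ← Sub.eq_top_iff',
      ← Sub.map_comap_of_surjective (f := e.hom) (fun i => (e.app i).surjective) W]
    rcases hE.eq_bot_or_eq_top (hE.1.isReg_comap hE' e.hom hW.1) with h | h <;> rw [h]
    · exact Or.inl (le_bot_iff.1 (Sub.map_le_iff_le_comap.2 bot_le))
    · refine Or.inr (top_le_iff.1 fun i x _ => ?_)
      obtain ⟨y, rfl⟩ := (e.app i).surjective x
      exact ⟨y, trivial, rfl⟩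

end Rep

end Regular

/-! ### Spaces of homomorphisms -/

section HomSpace

open Module

variable {k : Type u} [Field k] {I : Type w} [Quiver.{v} I]

namespace Rep

/-- The coboundary whose kernel is the space of homomorphisms from `A` to `B`: a family of linear
maps is sent to its failure to commute with the arrows. -/
def coboundary (A B : Rep k I) : (∀ i, A.V i →ₗ[k] B.V i) →ₗ[k]
    (∀ p : (Σ i j : I, i ⟶ j), A.V p.1 →ₗ[k] B.V p.2.1) :=
  LinearMap.pi fun p =>
    (LinearMap.lcomp k (B.V p.2.1) (A.map p.2.2)) ∘ₗ LinearMap.proj p.2.1 -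
      (LinearMap.llcomp k (A.V p.1) (B.V p.1) (B.V p.2.1) (B.map p.2.2)) ∘ₗ LinearMap.proj p.1

theorem coboundary_apply (A B : Rep k I) (f : ∀ i, A.V i →ₗ[k] B.V i) {i j : I} (h : i ⟶ j)
    (x : A.V i) : coboundary A B f ⟨i, j, h⟩ x = f j (A.map h x) - B.map h (f i x) := rfl

/-- The vector space of homomorphisms from `A` to `B`. -/
def homSpace (A B : Rep k I) : Submodule k (∀ i, A.V i →ₗ[k] B.V i) :=
  LinearMap.ker (coboundary A B)

theorem mem_homSpace {A B : Rep k I} {f : ∀ i, A.V i →ₗ[k] B.V i} :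
    f ∈ homSpace A B ↔ ∀ (i j : I) (h : i ⟶ j) (x : A.V i), f j (A.map h x) = B.map h (f i x) := by
  refine ⟨fun hf i j h x => ?_, fun hf => ?_⟩
  · rw [← sub_eq_zero, ← coboundary_apply, LinearMap.mem_ker.1 hf]
    rfl
  · refine funext fun p => LinearMap.ext fun x => ?_
    exact sub_eq_zero.2 (hf p.1 p.2.1 p.2.2 x)

theorem Hom.app_mem {A B : Rep k I} (f : Hom A B) : f.app ∈ homSpace A B :=
  mem_homSpace.2 fun _ _ h x => f.comm h x

/-- Postcomposition with a homomorphism. -/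
def postcomp (E : Rep k I) {A B : Rep k I} (f : Hom A B) : homSpace E A →ₗ[k] homSpace E B :=
  (LinearMap.pi fun i => (LinearMap.llcomp k (E.V i) (A.V i) (B.V i) (f.app i)) ∘ₗ
    LinearMap.proj i).restrict fun φ hφ => mem_homSpace.2 fun i j h x => by
      have := mem_homSpace.1 hφ i j h x
      simp [this, f.comm]

/-- Precomposition with a homomorphism. -/
def precomp {A B : Rep k I} (f : Hom A B) (E : Rep k I) : homSpace B E →ₗ[k] homSpace A E :=
  (LinearMap.pi fun i => (LinearMap.lcomp k (E.V i) (f.app i)) ∘ₗ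
    LinearMap.proj i).restrict fun φ hφ => mem_homSpace.2 fun i j h x => by
      have := mem_homSpace.1 hφ i j h (f.app i x)
      simp [← this, f.comm]

theorem postcomp_apply (E : Rep k I) {A B : Rep k I} (f : Hom A B) (φ : homSpace E A) (i : I)
    (x : E.V i) : (postcomp E f φ).1 i x = f.app i (φ.1 i x) := rfl

theorem precomp_apply {A B : Rep k I} (f : Hom A B) (E : Rep k I) (φ : homSpace B E) (i : I)
    (x : A.V i) : (precomp f E φ).1 i x = φ.1 i (f.app i x) := rfl

variable [Fintype I]

theorem finrank_homSpace (A B : Rep k I) :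
    (finrank k (homSpace A B) : ℤ) - finrank k (∀ i, A.V i →ₗ[k] B.V i) +
      finrank k (LinearMap.range (coboundary A B)) = 0 := by
  have h : finrank k (LinearMap.range (coboundary A B)) + finrank k (homSpace A B) = _ :=
    LinearMap.finrank_range_add_finrank_ker (coboundary A B)
  omega

variable [∀ i j : I, Fintype (i ⟶ j)]

theorem eulerForm_dimVec (A B : Rep k I) :
    eulerForm I (fun i => (A.dimVec i : ℤ)) (fun i => (B.dimVec i : ℤ)) =
      finrank k (∀ i, A.V i →ₗ[k] B.V i) -
        finrank k (∀ p : (Σ i j : I, i ⟶ j), A.V p.1 →ₗ[k] B.V p.2.1) := by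
  simp only [finrank_pi_fintype, finrank_linearMap, Fintype.sum_sigma, eulerForm, dimVec]
  push_cast
  rfl

/-- The rank of the coboundary of a pair drops by at most the dimension of the kernel of a
compatible surjection between the targets. When the Euler forms agree this bounds the spaces of
homomorphisms; it replaces the use of the long exact sequence for `Ext`. -/
theorem finrank_homSpace_le {A B A' B' : Rep k I}
    (hE : eulerForm I (fun i => (A.dimVec i : ℤ)) (fun i => (B.dimVec i : ℤ)) =
      eulerForm I (fun i => (A'.dimVec i : ℤ)) (fun i => (B'.dimVec i : ℤ)))
    (P₀ : (∀ i, A.V i →ₗ[k] B.V i) → (∀ i, A'.V i →ₗ[k] B'.V i))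
    (P₁ : (∀ p : (Σ i j : I, i ⟶ j), A.V p.1 →ₗ[k] B.V p.2.1) →ₗ[k]
      (∀ p : (Σ i j : I, i ⟶ j), A'.V p.1 →ₗ[k] B'.V p.2.1))
    (hP₁ : Function.Surjective P₁)
    (hP : ∀ f, P₁ (coboundary A B f) = coboundary A' B' (P₀ f)) :
    finrank k (homSpace A' B') ≤ finrank k (homSpace A B) := by
  rw [eulerForm_dimVec, eulerForm_dimVec] at hE
  have h1 := finrank_homSpace A B
  have h2 := finrank_homSpace A' B'
  have h3 := LinearMap.finrank_range_add_finrank_ker P₁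
  rw [LinearMap.range_eq_top.2 hP₁, finrank_top] at h3
  have h4 := LinearMap.finrank_range_add_finrank_ker
    (P₁.domRestrict (LinearMap.range (coboundary A B)))
  have h5 : finrank k (LinearMap.range (P₁.domRestrict (LinearMap.range (coboundary A B)))) ≤
      finrank k (LinearMap.range (coboundary A' B')) := by
    refine Submodule.finrank_mono ?_
    rintro _ ⟨⟨_, f, rfl⟩, rfl⟩
    exact ⟨P₀ f, (hP f).symm⟩
  have h6 : finrank k (LinearMap.ker (P₁.domRestrict (LinearMap.range (coboundary A B)))) ≤
      finrank k (LinearMap.ker P₁) := by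
    refine LinearMap.finrank_le_finrank_of_injective (f :=
      (Submodule.subtype _ ∘ₗ Submodule.subtype _).codRestrict _ fun x => x.2) ?_
    intro x y h
    have h' := congrArg Subtype.val h
    exact Subtype.ext (Subtype.ext h')
  omega

/-- `Hom(E, X) ⟶ Hom(E, Q)` behaves dimensionally like a surjection when `X ⟶ Q` is surjective and
its kernel is orthogonal to `E` for the Euler form. -/
theorem finrank_homSpace_le_of_surjective (E : Rep k I) {X Q : Rep k I} (g : Hom X Q)
    (hg : ∀ i, Function.Surjective (g.app i))
    (hE : eulerForm I (fun i => (E.dimVec i : ℤ)) (fun i => (X.dimVec i : ℤ)) =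
      eulerForm I (fun i => (E.dimVec i : ℤ)) (fun i => (Q.dimVec i : ℤ))) :
    finrank k (homSpace E Q) ≤ finrank k (homSpace E X) := by
  refine finrank_homSpace_le hE (fun f i => g.app i ∘ₗ f i)
    (LinearMap.pi fun p => (LinearMap.llcomp k (E.V p.1) (X.V p.2.1) (Q.V p.2.1)
      (g.app p.2.1)) ∘ₗ LinearMap.proj p) (fun φ => ?_) fun f => ?_
  · choose s hs using fun i => LinearMap.exists_rightInverse_of_surjective (g.app i)
      (LinearMap.range_eq_top.2 (hg i))
    refine ⟨fun p => s p.2.1 ∘ₗ φ p, funext fun p => LinearMap.ext fun x => ?_⟩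
    exact LinearMap.congr_fun (hs p.2.1) (φ p x)
  · refine funext fun ⟨i, j, h⟩ => LinearMap.ext fun x => ?_
    change g.app j (coboundary E X f ⟨i, j, h⟩ x) = _
    rw [coboundary_apply, coboundary_apply, map_sub, g.comm]
    rfl

/-- The dual of `finrank_homSpace_le_of_surjective`. -/
theorem finrank_homSpace_le_of_injective (E : Rep k I) {S X : Rep k I} (f : Hom S X)
    (hf : ∀ i, Function.Injective (f.app i))
    (hE : eulerForm I (fun i => (X.dimVec i : ℤ)) (fun i => (E.dimVec i : ℤ)) =
      eulerForm I (fun i => (S.dimVec i : ℤ)) (fun i => (E.dimVec i : ℤ))) :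
    finrank k (homSpace S E) ≤ finrank k (homSpace X E) := by
  refine finrank_homSpace_le hE (fun φ i => φ i ∘ₗ f.app i)
    (LinearMap.pi fun p => (LinearMap.lcomp k (E.V p.2.1) (f.app p.1)) ∘ₗ LinearMap.proj p)
    (fun φ => ?_) fun φ => ?_
  · choose r hr using fun i => LinearMap.exists_leftInverse_of_injective (f.app i)
      (LinearMap.ker_eq_bot.2 (hf i))
    refine ⟨fun p => φ p ∘ₗ r p.1, funext fun p => LinearMap.ext fun x => ?_⟩
    exact congrArg (φ p) (LinearMap.congr_fun (hr p.1) x)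
  · refine funext fun ⟨i, j, h⟩ => LinearMap.ext fun x => ?_
    change coboundary X E φ ⟨i, j, h⟩ (f.app i x) = _
    rw [coboundary_apply, coboundary_apply, ← f.comm]
    rfl

end Rep

end HomSpace

/-! ### Covers in the lattice of subrepresentations of defect zero -/

section Pure

open Module

variable {k : Type u} [Field k] {I : Type w} [Quiver.{v} I]

namespace Rep

theorem Sub.dimVec_subquot {M : Rep k I} {Y W : Sub M} (h : Y ≤ W) (i : I) :
    (subquot Y W).dimVec i + Y.toRep.dimVec i = W.toRep.dimVec i := by
  have h1 := congrFun (Y.comap W.incl).dimVec_quotient_add i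
  rw [Pi.add_apply, ← Sub.dimVec_map_of_injective W.incl_injective, Sub.map_comap_incl,
    inf_eq_left.2 h] at h1
  exact h1

variable [Fintype I] [∀ i j : I, Fintype (i ⟶ j)] {δ : I → ℕ}

/-- `M` is regular and all its regular composition factors are isomorphic to `E`. -/
structure IsPure (δ : I → ℕ) (M E : Rep k I) : Prop where
  isRegular : M.IsRegular δ
  iso_of_regCov : ∀ Y W : Sub M, Sub.RegCov δ Y W → Nonempty (Iso (Sub.subquot Y W) E)

theorem eulerForm_add_dimVec {A B C : Rep k I} (a : I → ℤ)
    (h : ∀ i, A.dimVec i + B.dimVec i = C.dimVec i) :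
    eulerForm I a (fun i => (C.dimVec i : ℤ)) =
      eulerForm I a (fun i => (A.dimVec i : ℤ)) + eulerForm I a (fun i => (B.dimVec i : ℤ)) := by
  rw [← eulerForm_add_right]
  congr 1
  funext i
  simp only [Pi.add_apply, ← h i, Nat.cast_add]

theorem eulerForm_dimVec_add {A B C : Rep k I} (a : I → ℤ)
    (h : ∀ i, A.dimVec i + B.dimVec i = C.dimVec i) :
    eulerForm I (fun i => (C.dimVec i : ℤ)) a =
      eulerForm I (fun i => (A.dimVec i : ℤ)) a + eulerForm I (fun i => (B.dimVec i : ℤ)) a := by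
  rw [← eulerForm_add_left]
  congr 1
  funext i
  simp only [Pi.add_apply, ← h i, Nat.cast_add]

theorem IsPure.dimVec_add {E M : Rep k I} (hM : M.IsPure δ E) {Y W : Sub M}
    (h : Sub.RegCov δ Y W) (i : I) : E.dimVec i + Y.toRep.dimVec i = W.toRep.dimVec i := by
  obtain ⟨e⟩ := hM.iso_of_regCov Y W h
  rw [← e.dimVec_eq, Sub.dimVec_subquot h.lt.le]

/-- The image of a nonzero map from a regular simple representation to `M / a` covers `a`. -/
theorem IsRegularSimple.regCov_range {E M : Rep k I} (hE : E.IsRegularSimple δ)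
    (hM : M.IsRegular δ) {a : Sub M} (ha : a.IsReg δ) (φ : Hom E a.quotient)
    (hφ : (⊤ : Sub E).map φ ≠ ⊥) : Sub.RegCov δ a (((⊤ : Sub E).map φ).comap a.mkQ) := by
  have hQ := hM.quotient ha
  refine ⟨ha, hM.isReg_comap hQ _ (hE.1.isReg_map hQ φ hE.1.isReg_top),
    lt_of_le_of_ne (a.le_comap_mkQ _) fun h => hφ ?_, fun V hV haV hVs => ?_⟩
  · rw [← Sub.map_comap_of_surjective a.mkQ_surjective ((⊤ : Sub E).map φ), ← h,
      ← le_bot_iff, Sub.map_le_iff_le_comap, Sub.comap_bot_mkQ]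
  · rcases hE.eq_bot_or_eq_top (hE.1.isReg_comap hQ φ (hM.isReg_map hQ a.mkQ hV)) with h | h
    · refine Or.inl (le_antisymm (fun i x hx => ?_) haV)
      obtain ⟨e, -, he⟩ := hVs i hx
      have : e ∈ ((V.map a.mkQ).comap φ).carrier i := by
        rw [Sub.mem_comap, he]
        exact ⟨x, hx, rfl⟩
      rw [h, Sub.bot_carrier, Submodule.mem_bot] at this
      rw [← a.mkQ_eq_zero, ← he, this, map_zero]
    · refine Or.inr (le_antisymm hVs fun i x hx => ?_)
      obtain ⟨e, -, he⟩ := hx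
      have : e ∈ ((V.map a.mkQ).comap φ).carrier i := by
        rw [h]
        trivial
      rw [Sub.mem_comap, he] at this
      rw [← Sub.comap_map_mkQ a V haV]
      exact this

/-- The kernel of a nonzero map from `a` to a regular simple representation is covered by `a`. -/
theorem IsRegularSimple.regCov_ker {E M : Rep k I} (hE : E.IsRegularSimple δ)
    (hM : M.IsRegular δ) {a : Sub M} (ha : a.IsReg δ) (φ : Hom a.toRep E)
    (hφ : (⊥ : Sub E).comap φ ≠ ⊤) : Sub.RegCov δ (((⊥ : Sub E).comap φ).map a.incl) a := by
  have hA := hM.toRep ha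
  have hle : ((⊥ : Sub E).comap φ).map a.incl ≤ a := fun i x ⟨y, _, hy⟩ => hy ▸ a.incl_mem y
  refine ⟨hA.isReg_map hM _ (hA.isReg_comap hE.1 φ Sub.isReg_bot), ha,
    lt_of_le_of_ne hle fun h => hφ ?_, fun V hV hsV hVa => ?_⟩
  · rw [← Sub.comap_map_of_injective a.incl_injective ((⊥ : Sub E).comap φ), h, ← top_le_iff]
    exact fun i x _ => a.incl_mem x
  · rcases hE.eq_bot_or_eq_top (hA.isReg_map hE.1 φ (hA.isReg_comap hM a.incl hV)) with h | h
    · refine Or.inl (le_antisymm (fun i x hx => ?_) hsV)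
      obtain ⟨y, rfl⟩ := a.exists_incl_eq (hVa i hx)
      have : φ.app i y ∈ ((V.comap a.incl).map φ).carrier i := ⟨y, hx, rfl⟩
      rw [h] at this
      exact ⟨y, this, rfl⟩
    · refine Or.inr (le_antisymm hVa fun i x hx => ?_)
      obtain ⟨y, rfl⟩ := a.exists_incl_eq hx
      have : φ.app i y ∈ ((V.comap a.incl).map φ).carrier i := by
        rw [h]
        trivial
      obtain ⟨z, hz, hzy⟩ := this
      have h1 : a.incl.app i (y - z) ∈ V.carrier i :=
        hsV i ⟨y - z, by
          change φ.app i (y - z) ∈ (⊥ : Submodule k (E.V i))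
          rw [map_sub, hzy, sub_self]
          exact zero_mem _, rfl⟩
      rw [map_sub] at h1
      have h2 := add_mem h1 hz
      rwa [sub_add_cancel] at h2

theorem finrank_lt_of_injective_of_notMem_range {V W : Type*} [AddCommGroup V] [Module k V]
    [AddCommGroup W] [Module k W] [Module.Finite k V] [Module.Finite k W] (f : V →ₗ[k] W)
    (hf : Function.Injective f) {x : W} (hx : ∀ y, f y ≠ x) : finrank k V < finrank k W := by
  refine lt_of_le_of_ne (LinearMap.finrank_le_finrank_of_injective hf) fun h => ?_
  obtain ⟨y, hy⟩ := (LinearMap.injective_iff_surjective_of_finrank_eq_finrank h).1 hf x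
  exact hx y hy

/-- If `⟨dim E, dim E⟩ = 0` then in a pure representation a regular subrepresentation `a` covered
by `s` has a second cover as soon as `s` has two: two covers of `s` make `Hom(E, M / s)` of
larger dimension than `End(E)`, hence also `Hom(E, M / a)`, so that some map `E ⟶ M / a` does not
land in `s / a`. -/
theorem IsPure.exists_regCov_ne {E M : Rep k I} (hE : E.IsRegularSimple δ)
    (h0 : eulerForm I (fun i => (E.dimVec i : ℤ)) (fun i => (E.dimVec i : ℤ)) = 0)
    (hM : M.IsPure δ E) {a s t₁ t₂ : Sub M} (hs : Sub.RegCov δ a s) (h₁ : Sub.RegCov δ s t₁)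
    (h₂ : Sub.RegCov δ s t₂) (hne : t₁ ≠ t₂) : ∃ s', Sub.RegCov δ a s' ∧ s' ≠ s := by
  by_contra! hcon
  have key {y t : Sub M} (h : Sub.RegCov δ y t) : ∃ j : Hom E y.quotient,
      (∀ i, Function.Injective (j.app i)) ∧ ((⊤ : Sub E).map j).comap y.mkQ = t := by
    obtain ⟨g, hg, hk⟩ := Sub.exists_hom_of_subquot_iso (hM.iso_of_regCov y t h)
    obtain ⟨j, hj⟩ := g.exists_comp_eq_of_surjective (y.mkQ.comp t.incl) hg
      (fun i x hx => y.mkQ_eq_zero.2 ((hk i x).1 hx))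
    refine ⟨j, fun i => (injective_iff_map_eq_zero _).2 fun e he => ?_, ?_⟩
    · obtain ⟨x, rfl⟩ := hg i e
      rw [hj] at he
      exact (hk i x).2 (y.mkQ_eq_zero.1 he)
    · have : (⊤ : Sub E).map j = t.map y.mkQ := by
        refine Sub.ext fun i x => ⟨?_, ?_⟩
        · rintro ⟨e, -, rfl⟩
          obtain ⟨x, rfl⟩ := hg i e
          exact ⟨_, t.incl_mem x, (hj i x).symm⟩
        · rintro ⟨x, hx, rfl⟩
          obtain ⟨x, rfl⟩ := t.exists_incl_eq hx
          exact ⟨g.app i x, trivial, hj i x⟩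
      rw [this, Sub.comap_map_mkQ _ _ h.lt.le]
  obtain ⟨js, hjs, hjs'⟩ := key hs
  obtain ⟨j₁, hj₁, hj₁'⟩ := key h₁
  obtain ⟨j₂, hj₂, hj₂'⟩ := key h₂
  have hd₁ : finrank k (homSpace E E) < finrank k (homSpace E s.quotient) := by
    refine finrank_lt_of_injective_of_notMem_range (postcomp E j₁) (fun φ ψ h => ?_)
      (x := ⟨j₂.app, j₂.app_mem⟩) fun φ h => hne ?_
    · refine Subtype.ext (funext fun i => LinearMap.ext fun x => hj₁ i ?_)
      rw [← postcomp_apply, ← postcomp_apply, h]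
    · have hle : t₂ ≤ t₁ := by
        rw [← hj₁', ← hj₂']
        refine Sub.comap_mono _ fun i x => ?_
        rintro ⟨e, -, rfl⟩
        refine ⟨φ.1 i e, trivial, ?_⟩
        rw [← postcomp_apply, h]
      rcases h₁.eq_or_eq t₂ h₂.right h₂.lt.le hle with h | h
      · exact absurd h h₂.lt.ne'
      · exact h.symm
  have hd₂ : finrank k (homSpace E s.quotient) ≤ finrank k (homSpace E a.quotient) := by
    obtain ⟨g, hg⟩ := a.mkQ.exists_comp_eq_of_surjective s.mkQ a.mkQ_surjective
      (fun i x hx => s.mkQ_eq_zero.2 (hs.lt.le i (a.mkQ_eq_zero.1 hx)))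
    refine finrank_homSpace_le_of_surjective E g (fun i y => ?_) ?_
    · obtain ⟨x, rfl⟩ := s.mkQ_surjective i y
      exact ⟨_, hg i x⟩
    · rw [eulerForm_add_dimVec (A := s.quotient) (B := E), h0, add_zero]
      intro i
      have h1 := hM.dimVec_add hs i
      have h2 := congrFun a.dimVec_quotient_add i
      have h3 := congrFun s.dimVec_quotient_add i
      simp only [Pi.add_apply] at h2 h3
      omega
  have hd₃ : finrank k (homSpace E a.quotient) ≤ finrank k (homSpace E E) := by
    have hsurj : Function.Surjective (postcomp E js) := fun φ => by
      let f : Hom E a.quotient := ⟨φ.1, fun {i j} h x => mem_homSpace.1 φ.2 i j h x⟩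
      have hle : (⊤ : Sub E).map f ≤ (⊤ : Sub E).map js := by
        by_cases h : (⊤ : Sub E).map f = ⊥
        · rw [h]
          exact bot_le
        · rw [← Sub.map_comap_of_surjective a.mkQ_surjective ((⊤ : Sub E).map f),
            hcon _ (hE.regCov_range hM.isRegular hs.left f h), ← hjs',
            Sub.map_comap_of_surjective a.mkQ_surjective]
      obtain ⟨ψ, hψ⟩ := js.exists_comp_eq_of_injective f hjs fun i x => by
        obtain ⟨y, -, hy⟩ := hle i ⟨x, trivial, rfl⟩
        exact ⟨y, hy⟩
      exact ⟨⟨ψ.app, ψ.app_mem⟩, Subtype.ext (funext fun i => LinearMap.ext fun x => hψ i x)⟩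
    exact LinearMap.finrank_le_finrank_of_surjective hsurj
  omega

/-- The dual of `IsPure.exists_regCov_ne`. -/
theorem IsPure.exists_regCov_ne' {E M : Rep k I} (hE : E.IsRegularSimple δ)
    (h0 : eulerForm I (fun i => (E.dimVec i : ℤ)) (fun i => (E.dimVec i : ℤ)) = 0)
    (hM : M.IsPure δ E) {a s t₁ t₂ : Sub M} (hs : Sub.RegCov δ s a) (h₁ : Sub.RegCov δ t₁ s)
    (h₂ : Sub.RegCov δ t₂ s) (hne : t₁ ≠ t₂) : ∃ s', Sub.RegCov δ s' a ∧ s' ≠ s := by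
  by_contra! hcon
  obtain ⟨q, hq, hqk⟩ := Sub.exists_hom_of_subquot_iso (hM.iso_of_regCov s a hs)
  obtain ⟨p₁, hp₁, hk₁⟩ := Sub.exists_hom_of_subquot_iso (hM.iso_of_regCov t₁ s h₁)
  obtain ⟨p₂, hp₂, hk₂⟩ := Sub.exists_hom_of_subquot_iso (hM.iso_of_regCov t₂ s h₂)
  have hd₁ : finrank k (homSpace E E) < finrank k (homSpace s.toRep E) := by
    refine finrank_lt_of_injective_of_notMem_range (precomp p₁ E) (fun φ ψ h => ?_)
      (x := ⟨p₂.app, p₂.app_mem⟩) fun φ h => hne ?_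
    · refine Subtype.ext (funext fun i => LinearMap.ext fun y => ?_)
      obtain ⟨x, rfl⟩ := hp₁ i y
      rw [← precomp_apply, ← precomp_apply, h]
    · have hle : t₁ ≤ t₂ := fun i x hx => by
        obtain ⟨y, rfl⟩ := s.exists_incl_eq (h₁.lt.le i hx)
        rw [← hk₂]
        change (⟨p₂.app, p₂.app_mem⟩ : homSpace s.toRep E).1 i y = 0
        rw [← h, precomp_apply, (hk₁ i y).2 hx, map_zero]
      rcases h₁.eq_or_eq t₂ h₂.left hle h₂.lt.le with h | h
      · exact h.symm
      · exact absurd h h₂.lt.ne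
  have hd₂ : finrank k (homSpace s.toRep E) ≤ finrank k (homSpace a.toRep E) := by
    obtain ⟨g, hg⟩ := a.incl.exists_comp_eq_of_injective s.incl a.incl_injective
      (fun i x => a.exists_incl_eq (hs.lt.le i (s.incl_mem x)))
    refine finrank_homSpace_le_of_injective E g (fun i x y hxy => s.incl_injective i ?_) ?_
    · rw [← hg, ← hg, hxy]
    · rw [eulerForm_dimVec_add (A := E) (B := s.toRep) (C := a.toRep) _ (hM.dimVec_add hs), h0,
        zero_add]
  have hd₃ : finrank k (homSpace a.toRep E) ≤ finrank k (homSpace E E) := by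
    have hsurj : Function.Surjective (precomp q E) := fun φ => by
      let f : Hom a.toRep E := ⟨φ.1, fun {i j} h x => mem_homSpace.1 φ.2 i j h x⟩
      have hle : ∀ i x, q.app i x = 0 → f.app i x = 0 := fun i x hx => by
        by_cases h : (⊥ : Sub E).comap f = ⊤
        · have : x ∈ ((⊥ : Sub E).comap f).carrier i := by
            rw [h]
            trivial
          exact this
        · have h1 := hcon _ (hE.regCov_ker hM.isRegular hs.right f h)
          have h2 := (hqk i x).1 hx
          rw [← h1] at h2
          obtain ⟨y, hy, hyx⟩ := h2
          rw [← a.incl_injective i hyx]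
          exact hy
      obtain ⟨ψ, hψ⟩ := q.exists_comp_eq_of_surjective f hq hle
      exact ⟨⟨ψ.app, ψ.app_mem⟩, Subtype.ext (funext fun i => LinearMap.ext fun x => hψ i x)⟩
    exact LinearMap.finrank_le_finrank_of_surjective hsurj
  omega

end Rep

end Pure

/-! ### A criterion for modular lattices to be chains -/

section ModularLattice

variable {α : Type*} [Lattice α]

/-- If the elements below `u` form a chain and `c` is maximal with `c ⊓ u = ⊥`, then `c` has at
most one cover, as each cover of `c` contains the atom below `u`. -/
theorem covBy_unique_of_maximal_disjoint [BoundedOrder α] {u c : α}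
    (hu : ∀ x y, x ≤ u → y ≤ u → x ≤ y ∨ y ≤ x)
    (hc : c ⊓ u = ⊥) (hmax : ∀ c', c < c' → c' ⊓ u ≠ ⊥) (s s' : α) (hs : c ⋖ s) (hs' : c ⋖ s') :
    s = s' := by
  have key (t t' : α) (ht : c ⋖ t) (ht' : c ⋖ t') (h : t ⊓ u ≤ t' ⊓ u) : t = t' := by
    have hlt : c < c ⊔ t ⊓ u := lt_of_le_of_ne le_sup_left fun h' => hmax t ht.lt
      (le_bot_iff.1 (hc ▸ le_inf (h'.symm ▸ le_sup_right) inf_le_right))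
    have h1 := ht.eq_or_eq hlt.le (sup_le ht.le inf_le_left)
    have h2 := ht'.eq_or_eq hlt.le (sup_le ht'.le (h.trans inf_le_left))
    rw [← h1.resolve_left hlt.ne', h2.resolve_left hlt.ne']
  rcases hu (s ⊓ u) (s' ⊓ u) inf_le_right inf_le_right with h | h
  · exact key s s' hs hs' h
  · exact (key s' s hs' hs h).symm

variable [Finite α]

/-- If an element that is the unique cover of something has at most one cover itself, then the
elements above one with at most one cover form a chain. -/
theorem isChain_Ici_of_unique_covBy
    (hA : ∀ a s t₁ t₂ : α, a ⋖ s → s ⋖ t₁ → s ⋖ t₂ → t₁ ≠ t₂ → ∃ s', a ⋖ s' ∧ s' ≠ s) (a : α)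
    (ha : ∀ s s', a ⋖ s → a ⋖ s' → s = s') (x y : α) (hx : a ≤ x) (hy : a ≤ y) :
    x ≤ y ∨ y ≤ x := by
  induction a using WellFoundedGT.induction with
  | ind a ih =>
    rcases hx.eq_or_lt with rfl | hx
    · exact Or.inl hy
    rcases hy.eq_or_lt with rfl | hy
    · exact Or.inr hx.le
    obtain ⟨s, hs, hsx⟩ := exists_covBy_le_of_lt hx
    obtain ⟨s', hs', hsy⟩ := exists_covBy_le_of_lt hy
    obtain rfl := ha s s' hs hs'
    refine ih s hs.lt (fun t t' ht ht' => ?_) hsx hsy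
    by_contra h
    obtain ⟨s', h1, h2⟩ := hA a s t t' hs ht ht' h
    exact h2 (ha _ _ h1 hs)

variable [BoundedOrder α] [IsModularLattice α]

/-- A finite modular lattice without nontrivial complements is a chain when, locally, two covers of
`s` force a second cover of each `a ⋖ s`, and dually. A largest chain `[⊥, u]` is compared with
`[c, ⊤]` for `c` maximal disjoint from `u`, and this with `[⊥, d]` for `d` minimal generating `⊤`
together with `c`; all of them are chains, so by maximality `u` and `c` are complements. -/
theorem isChain_of_covBy_of_isCompl
    (hA : ∀ a s t₁ t₂ : α, a ⋖ s → s ⋖ t₁ → s ⋖ t₂ → t₁ ≠ t₂ → ∃ s', a ⋖ s' ∧ s' ≠ s)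
    (hA' : ∀ a s t₁ t₂ : α, s ⋖ a → t₁ ⋖ s → t₂ ⋖ s → t₁ ≠ t₂ → ∃ s', s' ⋖ a ∧ s' ≠ s)
    (hI : ∀ x y : α, IsCompl x y → x = ⊥ ∨ y = ⊥) (x y : α) : x ≤ y ∨ y ≤ x := by
  let S : Set α := {u | ∀ x y, x ≤ u → y ≤ u → x ≤ y ∨ y ≤ x}
  obtain ⟨u, hu, humax⟩ := S.toFinite.exists_maximalFor (fun u => Nat.card (Set.Icc ⊥ u)) S
    ⟨⊥, fun x y hx _ => Or.inl ((le_bot_iff.1 hx).symm ▸ bot_le)⟩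
  obtain ⟨c, hc, hcmax⟩ := (Set.toFinite {c : α | c ⊓ u = ⊥}).exists_maximal ⟨⊥, bot_inf_eq u⟩
  have hcu := covBy_unique_of_maximal_disjoint hu hc
    (fun c' h h' => (hcmax h' h.le).not_gt h)
  have hctop := isChain_Ici_of_unique_covBy hA c hcu
  obtain ⟨d, hd, hdmin⟩ := (Set.toFinite {d : α | d ⊔ c = ⊤}).exists_minimal ⟨⊤, top_sup_eq c⟩
  have hdu := covBy_unique_of_maximal_disjoint (α := αᵒᵈ) (u := OrderDual.toDual c)
    (c := OrderDual.toDual d) (fun x y hx hy => (hctop _ _ hx hy).symm) hd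
    (fun c' h h' => (hdmin h' h.le).not_gt h)
  have hdbot := isChain_Ici_of_unique_covBy (α := αᵒᵈ)
    (fun a s t₁ t₂ h1 h2 h3 h4 => by
      obtain ⟨s', h5, h6⟩ := hA' (OrderDual.ofDual a) (OrderDual.ofDual s) (OrderDual.ofDual t₁)
        (OrderDual.ofDual t₂) h1.ofDual h2.ofDual h3.ofDual h4
      exact ⟨OrderDual.toDual s', h5.toDual, h6⟩) (OrderDual.toDual d) hdu
  have hdS : d ∈ S := fun x y hx hy => (hdbot x y hx hy).symm
  have hle : Nat.card (Set.Icc ⊥ d) ≤ Nat.card (Set.Icc ⊥ u) := by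
    rcases le_total (Nat.card (Set.Icc ⊥ d)) (Nat.card (Set.Icc ⊥ u)) with h | h
    · exact h
    · exact humax hdS h
  have e1 : Nat.card (Set.Icc (u ⊓ c) u) = Nat.card (Set.Icc c (u ⊔ c)) :=
    Nat.card_congr (infIccOrderIsoIccSup u c).toEquiv
  have e2 : Nat.card (Set.Icc (d ⊓ c) d) = Nat.card (Set.Icc c (d ⊔ c)) :=
    Nat.card_congr (infIccOrderIsoIccSup d c).toEquiv
  have e3 : Nat.card (Set.Icc (d ⊓ c) d) ≤ Nat.card (Set.Icc ⊥ d) :=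
    Nat.card_mono (Set.toFinite _) (Set.Icc_subset_Icc_left bot_le)
  have hc' : u ⊓ c = ⊥ := by rw [inf_comm]; exact hc
  have hd' : d ⊔ c = ⊤ := hd
  rw [hc'] at e1
  rw [hd'] at e2
  have htop : u ⊔ c = ⊤ := by
    have hsub : Set.Icc c (u ⊔ c) ⊆ Set.Icc c ⊤ := Set.Icc_subset_Icc_right le_top
    have heq := Set.eq_of_subset_of_ncard_le hsub
      (by rw [← Nat.card_coe_set_eq, ← Nat.card_coe_set_eq]; omega) (Set.toFinite _)
    have : (⊤ : α) ∈ Set.Icc c (u ⊔ c) := by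
      rw [heq]
      exact ⟨le_top, le_rfl⟩
    exact top_le_iff.1 this.2
  rcases hI u c ⟨disjoint_iff.2 hc', codisjoint_iff.2 htop⟩ with h | h
  · refine hctop x y ?_ ?_ <;>
    · -- With `u = ⊥` maximality forbids atoms, so the lattice is trivial.
      have hbot : ∀ z : α, z = ⊥ := fun z => by
        by_contra hz
        obtain ⟨s, hs, -⟩ := exists_covBy_le_of_lt (bot_lt_iff_ne_bot.2 hz)
        have hsS : s ∈ S := fun x y hx hy => by
          rcases hs.eq_or_eq bot_le hx with rfl | rfl
          · exact Or.inl bot_le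
          · exact Or.inr hy
        have h1 : Nat.card (Set.Icc ⊥ s) ≤ Nat.card (Set.Icc ⊥ u) := by
          rcases le_total (Nat.card (Set.Icc ⊥ s)) (Nat.card (Set.Icc ⊥ u)) with h | h
          · exact h
          · exact humax hsS h
        have h2 : (Set.Icc ⊥ u) ⊂ Set.Icc ⊥ s := by
          rw [h]
          exact ⟨Set.Icc_subset_Icc_right bot_le, fun h' =>
            hs.lt.ne' (le_bot_iff.1 (h' ⟨bot_le, le_rfl⟩).2)⟩
        have h3 := Set.ncard_lt_ncard h2 (Set.toFinite _)
        rw [← Nat.card_coe_set_eq, ← Nat.card_coe_set_eq] at h3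
        omega
      rw [hbot c]
      exact bot_le
  · rw [h, sup_bot_eq] at htop
    exact hu x y (htop ▸ le_top) (htop ▸ le_top)

end ModularLattice

/-! ### Uniserial regular representations -/

section Uniserial

open Module

variable {k : Type u} [Field k] {I : Type w} [Quiver.{v} I]

namespace Rep

theorem HasFiltration.dimVec_eq {E : Rep k I} {n : ℕ} {M : Rep k I}
    (h : M.HasFiltration (isoClass E) n) : M.dimVec = n • E.dimVec := by
  induction n generalizing M with
  | zero =>
    rw [zero_smul]
    have h' : ∀ i, Subsingleton (M.V i) := h
    exact funext fun i => finrank_zero_of_subsingleton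
  | succ n ih =>
    obtain ⟨W, hW, hE⟩ := h
    obtain ⟨e⟩ := isoClass_eq_iff.1 hE
    rw [← W.dimVec_quotient_add, ih hW, e.dimVec_eq, add_smul, one_smul, add_comm]

theorem smul_dimVec_injective {I : Type*} {d : I → ℕ} (hd : d ≠ 0) :
    Function.Injective fun n : ℕ => n • d := by
  intro a b h
  obtain ⟨i, hi⟩ := Function.ne_iff.1 hd
  exact mul_right_cancel₀ hi (congrFun h i)

variable [Fintype I] [∀ i j : I, Fintype (i ⟶ j)] {δ : I → ℕ}

theorem Sub.RegCov.map_incl {M : Rep k I} (hM : M.IsRegular δ) {W : Sub M} (hW : W.IsReg δ)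
    {Y V : Sub W.toRep} (h : RegCov δ Y V) : RegCov δ (Y.map W.incl) (V.map W.incl) := by
  have hR := hM.toRep hW
  refine ⟨hR.isReg_map hM _ h.left, hR.isReg_map hM _ h.right,
    lt_of_le_of_ne (map_mono _ h.lt.le) fun he => h.lt.ne ?_, fun U hU hYU hUV => ?_⟩
  · rw [← comap_map_of_injective W.incl_injective Y, he, comap_map_of_injective W.incl_injective]
  · have hUW : U ≤ W := hUV.trans fun i x ⟨y, _, hy⟩ => hy ▸ W.incl_mem y
    have hU' : (U.comap W.incl).map W.incl = U := by rw [map_comap_incl, inf_eq_left.2 hUW]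
    have h1 := h.eq_or_eq (U.comap W.incl) (hR.isReg_comap hM _ hU)
      (map_le_iff_le_comap.1 hYU) (by
        rw [← comap_map_of_injective W.incl_injective V]
        exact comap_mono _ hUV)
    rw [← hU']
    exact h1.imp (congrArg _) (congrArg _)

theorem Sub.RegCov.comap_mkQ {M : Rep k I} (hM : M.IsRegular δ) {W : Sub M} (hW : W.IsReg δ)
    {Y V : Sub W.quotient} (h : RegCov δ Y V) : RegCov δ (Y.comap W.mkQ) (V.comap W.mkQ) := by
  have hR := hM.quotient hW
  refine ⟨hM.isReg_comap hR _ h.left, hM.isReg_comap hR _ h.right,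
    lt_of_le_of_ne (comap_mono _ h.lt.le) fun he => h.lt.ne ?_, fun U hU hYU hUV => ?_⟩
  · rw [← map_comap_of_surjective W.mkQ_surjective Y, he,
      map_comap_of_surjective W.mkQ_surjective]
  · have hU' := comap_map_mkQ W U ((W.le_comap_mkQ Y).trans hYU)
    have h1 := h.eq_or_eq (U.map W.mkQ) (hM.isReg_map hR _ hU) (by
        rw [← map_comap_of_surjective W.mkQ_surjective Y]
        exact map_mono _ hYU) (map_le_iff_le_comap.2 hUV)
    rw [← hU']
    exact h1.imp (congrArg _) (congrArg _)

theorem IsPure.toRep {M E : Rep k I} (hM : M.IsPure δ E) {W : Sub M} (hW : W.IsReg δ) :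
    W.toRep.IsPure δ E := by
  refine ⟨hM.isRegular.toRep hW, fun Y V h => iso_trans ?_
    (hM.iso_of_regCov _ _ (h.map_incl hM.isRegular hW))⟩
  refine Sub.subquot_iso W.incl (Sub.map_le_iff_le_comap.1 le_rfl) (fun i x _ => ?_) le_sup_left
  rw [← Sub.mem_comap, Sub.comap_map_of_injective W.incl_injective]

theorem IsPure.quotient {M E : Rep k I} (hM : M.IsPure δ E) {W : Sub M} (hW : W.IsReg δ) :
    W.quotient.IsPure δ E := by
  refine ⟨hM.isRegular.quotient hW, fun Y V h => iso_trans (iso_symm ?_)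
    (hM.iso_of_regCov _ _ (h.comap_mkQ hM.isRegular hW))⟩
  refine Sub.subquot_iso W.mkQ le_rfl (fun i x _ => Iff.rfl) ?_
  rw [Sub.map_comap_of_surjective W.mkQ_surjective]
  exact le_sup_left

/-- A form of the Jordan--Hölder theorem. -/
theorem HasFiltration.isPure {E : Rep k I} (hE : E.IsRegularSimple δ) {n : ℕ} {M : Rep k I}
    (h : M.HasFiltration (isoClass E) n) : M.IsPure δ E := by
  induction n generalizing M with
  | zero =>
    have h' : ∀ i, Subsingleton (M.V i) := h
    have hle (Y W : Sub M) : Y ≤ W := fun i x _ => by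
      rw [Subsingleton.elim x 0]
      exact zero_mem _
    have hd (W : Sub M) : W.toRep.defect δ = 0 := by
      rw [le_antisymm (hle W ⊥) (hle _ _)]
      exact Sub.isReg_bot
    refine ⟨⟨?_, fun W => (hd W).le⟩, fun Y W hYW => absurd (hle W Y) hYW.lt.not_ge⟩
    rw [← defect_congr δ (dimVec_top M)]
    exact hd ⊤
  | succ n ih =>
    obtain ⟨W, hW, hQ⟩ := h
    have hW := ih hW
    have hQ := isoClass_eq_iff.1 hQ
    have hQs := hE.of_iso (iso_symm hQ)
    have hM : M.IsRegular δ := hW.isRegular.of_sub_of_quotient hQs.1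
    have hWr : W.IsReg δ := hW.isRegular.1
    refine ⟨hM, fun Y V hYV => ?_⟩
    by_cases hinf : V ⊓ W ≤ Y
    · -- Here `V / Y` is isomorphic to `M / W`.
      have htop (U : Sub M) (hU : U.IsReg δ) : U ⊔ W = W ∨ U ⊔ W = ⊤ := by
        have h1 := (hM.isReg_sup_and_inf hU hWr).1
        rcases hQs.eq_bot_or_eq_top (hM.isReg_map hQs.1 W.mkQ h1) with h2 | h2
        · left
          rw [← Sub.comap_map_mkQ W _ (le_sup_right : W ≤ U ⊔ W), h2, Sub.comap_bot_mkQ]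
        · right
          rw [← Sub.comap_map_mkQ W _ (le_sup_right : W ≤ U ⊔ W), h2]
          rfl
      have hinf' : V ⊓ W ≤ Y ⊓ W := le_inf hinf inf_le_right
      have hV : V ⊔ W = ⊤ ∧ Y ≤ W := by
        rcases htop V hYV.right with h1 | h1
        · exact absurd ((le_inf le_rfl (h1 ▸ le_sup_left)).trans hinf) hYV.lt.not_ge
        · refine ⟨h1, ?_⟩
          rcases htop Y hYV.left with h2 | h2
          · exact h2 ▸ le_sup_left
          · exact absurd (eq_of_le_of_inf_le_of_sup_le hYV.lt.le hinf' (by rw [h2]; exact le_top))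
              hYV.lt.ne
      refine iso_trans ?_ (iso_trans (Sub.subquot_top_iso W) hQ)
      refine Sub.subquot_iso (Hom.id M) (fun _ _ _ => trivial)
        (fun i x hx => ⟨fun h => hinf i ⟨hx, h⟩, fun h => hV.2 i h⟩) ?_
      rw [← hV.1]
      exact sup_le_sup_right (fun i x hx => ⟨x, hx, rfl⟩) _
    · -- Here `V / Y` is isomorphic to `(V ∩ W) / (Y ∩ W)`.
      have hVW : V = V ⊓ W ⊔ Y := by
        rcases hYV.eq_or_eq (V ⊓ W ⊔ Y)
          (hM.isReg_sup_and_inf (hM.isReg_sup_and_inf hYV.right hWr).2 hYV.left).1 le_sup_right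
          (sup_le inf_le_left hYV.lt.le) with h1 | h1
        · exact absurd (h1 ▸ le_sup_left) hinf
        · exact h1.symm
      have hcov : Sub.RegCov δ (Y.comap W.incl) (V.comap W.incl) := by
        refine ⟨hW.isRegular.isReg_comap hM _ hYV.left, hW.isRegular.isReg_comap hM _ hYV.right,
          lt_of_le_of_ne (Sub.comap_mono _ hYV.lt.le) fun h => hinf ?_, fun U hU h1 h2 => ?_⟩
        · rw [← Sub.map_comap_incl, ← h, Sub.map_comap_incl]
          exact inf_le_left
        · have hUW : U.map W.incl ≤ W := fun i x ⟨y, _, hy⟩ => hy ▸ W.incl_mem y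
          have hUV : U.map W.incl ≤ V := Sub.map_le_iff_le_comap.2 h2
          rw [← Sub.comap_map_of_injective W.incl_injective U]
          rcases hYV.eq_or_eq (Y ⊔ U.map W.incl)
            (hM.isReg_sup_and_inf hYV.left (hW.isRegular.isReg_map hM _ hU)).1 le_sup_left
            (sup_le hYV.lt.le hUV) with h3 | h3
          · left
            refine le_antisymm (Sub.comap_mono _ (h3 ▸ le_sup_right)) ?_
            rw [Sub.comap_map_of_injective W.incl_injective]
            exact h1
          · right
            have h4 : V ⊓ W ≤ U.map W.incl := by
              rw [← h3, sup_comm, sup_inf_assoc_of_le _ hUW]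
              refine sup_le le_rfl ?_
              rw [← Sub.map_comap_incl]
              exact Sub.map_mono _ h1
            refine le_antisymm (Sub.comap_mono _ hUV) fun i x hx => ?_
            exact h4 i ⟨hx, W.incl_mem x⟩
      refine iso_trans (iso_symm ?_) (hW.iso_of_regCov _ _ hcov)
      refine Sub.subquot_iso W.incl le_rfl (fun i x _ => Iff.rfl) ?_
      rw [Sub.map_comap_incl]
      exact hVW.le

theorem Sub.exists_regCov_of_lt [Finite k] {M : Rep k I} {Y W : Sub M} (hY : Y.IsReg δ)
    (hW : W.IsReg δ)
    (h : Y < W) : ∃ V, Y ≤ V ∧ RegCov δ V W := by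
  obtain ⟨V, ⟨hV, hYV, hVW⟩, hmax⟩ := (Set.toFinite {V : Sub M | V.IsReg δ ∧ Y ≤ V ∧
    V < W}).exists_maximal ⟨Y, hY, le_rfl, h⟩
  refine ⟨V, hYV, hV, hW, hVW, fun U hU hVU hUW => ?_⟩
  rcases hUW.eq_or_lt with h | h
  · exact Or.inr h
  · exact Or.inl (le_antisymm (hmax ⟨hU, hYV.trans hVU, h⟩ hVU) hVU)

theorem IsPure.exists_dimVec_eq [Finite k] {M E : Rep k I} (hM : M.IsPure δ E) {W : Sub M}
    (hW : W.IsReg δ) : ∃ j : ℕ, W.toRep.dimVec = j • E.dimVec := by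
  induction W using WellFoundedLT.induction with
  | ind W ih =>
    rcases (bot_le : ⊥ ≤ W).eq_or_lt with h | h
    · exact ⟨0, by rw [← h, dimVec_bot, zero_smul]⟩
    · obtain ⟨V, -, hV⟩ := Sub.exists_regCov_of_lt Sub.isReg_bot hW h
      obtain ⟨j, hj⟩ := ih V hV.lt hV.left
      refine ⟨j + 1, funext fun i => ?_⟩
      rw [← hM.dimVec_add hV i, hj, add_smul, one_smul, add_comm]
      rfl

theorem IsRegularSimple.dimVec_ne_zero {E : Rep k I} (hE : E.IsRegularSimple δ) :
    E.dimVec ≠ 0 := fun h => by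
  obtain ⟨i, hi⟩ := hE.2.1
  exact (finrank_pos (R := k) (M := E.V i)).ne' (congrFun h i)

theorem IsPure.exists_regCov_top [Finite k] {M E : Rep k I} (hE : E.IsRegularSimple δ)
    (hM : M.IsPure δ E) {n : ℕ} (hn : M.dimVec = (n + 1) • E.dimVec) :
    ∃ V : Sub M, Sub.RegCov δ V ⊤ ∧ V.toRep.dimVec = n • E.dimVec := by
  have hlt : (⊥ : Sub M) < ⊤ := by
    refine lt_of_le_of_ne bot_le fun h => hE.dimVec_ne_zero ?_
    have h1 : M.dimVec = 0 := by rw [← dimVec_top, ← h, dimVec_bot]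
    rw [hn] at h1
    exact (smul_eq_zero.1 h1).resolve_left n.succ_ne_zero
  obtain ⟨V, -, hV⟩ := Sub.exists_regCov_of_lt Sub.isReg_bot hM.isRegular.isReg_top hlt
  refine ⟨V, hV, funext fun i => ?_⟩
  have h1 := hM.dimVec_add hV i
  rw [dimVec_top, hn, add_smul, one_smul, Pi.add_apply] at h1
  omega

theorem IsPure.exists_sub_dimVec_eq [Finite k] {M E : Rep k I} (hE : E.IsRegularSimple δ)
    (hM : M.IsPure δ E) {j m : ℕ} (hn : M.dimVec = (j + m) • E.dimVec) :
    ∃ W : Sub M, W.IsReg δ ∧ W.toRep.dimVec = j • E.dimVec := by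
  induction m generalizing M with
  | zero => exact ⟨⊤, hM.isRegular.isReg_top, by rw [dimVec_top, hn, add_zero]⟩
  | succ m ih =>
    obtain ⟨V, hV, hVd⟩ := hM.exists_regCov_top hE hn
    obtain ⟨W, hW, hWd⟩ := ih (hM.toRep hV.left) hVd
    exact ⟨W.map V.incl, (hM.isRegular.toRep hV.left).isReg_map hM.isRegular _ hW,
      (Sub.dimVec_map_of_injective V.incl_injective W).trans hWd⟩

theorem IsPure.hasFiltration [Finite k] {M E : Rep k I} (hE : E.IsRegularSimple δ)
    (hM : M.IsPure δ E)
    {n : ℕ} (hn : M.dimVec = n • E.dimVec) : M.HasFiltration (isoClass E) n := by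
  induction n generalizing M with
  | zero =>
    rw [zero_smul] at hn
    exact fun i => finrank_zero_iff.1 (congrFun hn i)
  | succ n ih =>
    obtain ⟨V, hV, hVd⟩ := hM.exists_regCov_top hE hn
    exact ⟨V, ih (hM.toRep hV.left) hVd, isoClass_eq_iff.2
      (iso_trans (iso_symm (Sub.subquot_top_iso V)) (hM.iso_of_regCov _ _ hV))⟩

/-- `M` is pure of type `E`, of regular length `n`, and its regular subrepresentations form a
chain. -/
structure IsUniserial (δ : I → ℕ) (M E : Rep k I) (n : ℕ) : Prop extends IsPure δ M E where
  dimVec_eq : M.dimVec = n • E.dimVec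
  total : ∀ W W' : Sub M, W.IsReg δ → W'.IsReg δ → W ≤ W' ∨ W' ≤ W

/-- The modular lattice of the regular subrepresentations of a regular representation. -/
def IsRegular.sublattice {M : Rep k I} (hM : M.IsRegular δ) : Sublattice (Sub M) where
  carrier := {W | W.IsReg δ}
  supClosed' _ h _ h' := (hM.isReg_sup_and_inf h h').1
  infClosed' _ h _ h' := (hM.isReg_sup_and_inf h h').2

/-- An indecomposable pure representation of type `E` with `⟨dim E, dim E⟩ = 0` is uniserial. -/
theorem IsPure.isUniserial [Finite k] {M E : Rep k I} (hE : E.IsRegularSimple δ)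
    (h0 : eulerForm I (fun i => (E.dimVec i : ℤ)) (fun i => (E.dimVec i : ℤ)) = 0)
    (hM : M.IsPure δ E) (hind : M.Indecomposable) {n : ℕ} (hn : M.dimVec = n • E.dimVec) :
    M.IsUniserial δ E n := by
  refine ⟨hM, hn, ?_⟩
  let L := hM.isRegular.sublattice
  let _ : BoundedOrder L :=
    { top := ⟨⊤, hM.isRegular.isReg_top⟩
      le_top := fun W => (le_top : W.1 ≤ ⊤)
      bot := ⟨⊥, Sub.isReg_bot⟩
      bot_le := fun W => (bot_le : ⊥ ≤ W.1) }
  have : IsModularLattice L :=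
    ⟨fun {x} y {z} h => IsModularLattice.sup_inf_le_assoc_of_le (α := Sub M) y.1 h⟩
  have hcov (x y : L) : x ⋖ y ↔ Sub.RegCov δ x.1 y.1 := by
    refine ⟨fun h => ⟨x.2, y.2, h.lt, fun V hV h1 h2 => ?_⟩, fun h => ⟨h.lt, fun z h1 h2 => ?_⟩⟩
    · exact (h.eq_or_eq (c := ⟨V, hV⟩) h1 h2).imp (congrArg Subtype.val) (congrArg Subtype.val)
    · rcases h.eq_or_eq z.1 z.2 h1.le h2.le with h3 | h3
      · exact h1.ne (Subtype.ext h3).symm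
      · exact h2.ne (Subtype.ext h3)
  have key := isChain_of_covBy_of_isCompl (α := L) (fun a s t₁ t₂ h1 h2 h3 h4 => by
      rw [hcov] at h1 h2 h3
      obtain ⟨s', h5, h6⟩ := hM.exists_regCov_ne hE h0 h1 h2 h3 fun h => h4 (Subtype.ext h)
      exact ⟨⟨s', h5.right⟩, (hcov _ _).2 h5, fun h => h6 (congrArg Subtype.val h)⟩)
    (fun a s t₁ t₂ h1 h2 h3 h4 => by
      rw [hcov] at h1 h2 h3
      obtain ⟨s', h5, h6⟩ := hM.exists_regCov_ne' hE h0 h1 h2 h3 fun h => h4 (Subtype.ext h)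
      exact ⟨⟨s', h5.left⟩, (hcov _ _).2 h5, fun h => h6 (congrArg Subtype.val h)⟩)
    (fun x y h => by
      have h1 : x.1 ⊓ y.1 = ⊥ := congrArg Subtype.val h.inf_eq_bot
      have h2 : x.1 ⊔ y.1 = ⊤ := congrArg Subtype.val h.sup_eq_top
      refine (hind.2 x.1 y.1 fun i => ⟨disjoint_iff.2 ?_, codisjoint_iff.2 ?_⟩).imp
        (fun h => Subtype.ext (Sub.eq_bot_iff'.2 h)) fun h => Subtype.ext (Sub.eq_bot_iff'.2 h)
      · exact congrFun (congrArg Sub.carrier h1) i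
      · exact congrFun (congrArg Sub.carrier h2) i)
  exact fun W W' hW hW' => key ⟨W, hW⟩ ⟨W', hW'⟩

/-- Each of two complementary subrepresentations of a regular representation has defect at most
zero, hence both are regular, and a chain contains no nontrivial complements. -/
theorem IsUniserial.indecomposable {M E : Rep k I} {n : ℕ} (hE : E.IsRegularSimple δ)
    (hM : M.IsUniserial δ E n) (hn : n ≠ 0) : M.Indecomposable := by
  refine ⟨?_, fun W W' h => ?_⟩
  · obtain ⟨i, hi⟩ := Function.ne_iff.1 hE.dimVec_ne_zero
    refine ⟨i, nontrivial_of_finrank_pos (R := k) (Nat.pos_of_ne_zero ?_)⟩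
    change M.dimVec i ≠ 0
    rw [hM.dimVec_eq]
    exact mul_ne_zero hn hi
  · have h1 : W ⊓ W' = ⊥ := Sub.carrier_injective (funext fun i => (h i).inf_eq_bot)
    have h2 : W ⊔ W' = ⊤ := Sub.carrier_injective (funext fun i => (h i).sup_eq_top)
    have h3 := defect_add_eq δ (W.dimVec_sup_add_inf W')
    rw [h1, h2, show Rep.defect δ (⊥ : Sub M).toRep = 0 from Sub.isReg_bot,
      show Rep.defect δ (⊤ : Sub M).toRep = 0 from hM.isRegular.isReg_top] at h3
    have h4 := hM.isRegular.2 W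
    have h5 := hM.isRegular.2 W'
    rw [← Sub.eq_bot_iff', ← Sub.eq_bot_iff']
    rcases hM.total W W' (by unfold Sub.IsReg; omega) (by unfold Sub.IsReg; omega) with h | h
    · exact Or.inl (by rw [← h1, inf_eq_left.2 h])
    · exact Or.inr (by rw [← h1, inf_eq_right.2 h])

theorem IsUniserial.toRep {M E : Rep k I} {n j : ℕ} (hM : M.IsUniserial δ E n) {W : Sub M}
    (hW : W.IsReg δ) (hj : W.toRep.dimVec = j • E.dimVec) : W.toRep.IsUniserial δ E j := by
  have hR := hM.isRegular.toRep hW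
  refine ⟨hM.toIsPure.toRep hW, hj, fun V V' hV hV' => ?_⟩
  rw [← Sub.comap_map_of_injective W.incl_injective V,
    ← Sub.comap_map_of_injective W.incl_injective V']
  exact (hM.total _ _ (hR.isReg_map hM.isRegular W.incl hV)
    (hR.isReg_map hM.isRegular W.incl hV')).imp (Sub.comap_mono _) (Sub.comap_mono _)

theorem IsUniserial.quotient {M E : Rep k I} {n j m : ℕ} (hM : M.IsUniserial δ E n) {W : Sub M}
    (hW : W.IsReg δ) (hj : W.toRep.dimVec = j • E.dimVec) (hm : m + j = n) :
    W.quotient.IsUniserial δ E m := by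
  have hR := hM.isRegular.quotient hW
  refine ⟨hM.toIsPure.quotient hW, ?_, fun V V' hV hV' => ?_⟩
  · have := W.dimVec_quotient_add
    rw [hj, hM.dimVec_eq, ← hm, add_smul] at this
    exact add_right_cancel this
  · rw [← Sub.map_comap_of_surjective W.mkQ_surjective V,
      ← Sub.map_comap_of_surjective W.mkQ_surjective V']
    exact (hM.total _ _ (hM.isRegular.isReg_comap hR W.mkQ hV)
      (hM.isRegular.isReg_comap hR W.mkQ hV')).imp (Sub.map_mono _) (Sub.map_mono _)

theorem IsUniserial.eq_of_dimVec_eq {M E : Rep k I} {n : ℕ} (hM : M.IsUniserial δ E n)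
    {W W' : Sub M} (hW : W.IsReg δ) (hW' : W'.IsReg δ) (h : W.toRep.dimVec = W'.toRep.dimVec) :
    W = W' :=
  (hM.total W W' hW hW').elim (fun hle => Sub.eq_of_le_of_dimVec_eq hle h)
    fun hle => (Sub.eq_of_le_of_dimVec_eq hle h.symm).symm

end Rep

end Uniserial

/-! ### Direct sums of uniserial representations from different tubes -/

section DirectSum

open Module

variable {k : Type u} [Field k] {I : Type w} [Quiver.{v} I] {l : ℕ}

namespace Rep

/-- The inclusion of a summand. -/
def single (N : Fin l → Rep k I) (a : Fin l) : Hom (N a) (directSum N) :=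
  ⟨fun i => LinearMap.single k (fun b => (N b).V i) a, fun {i j} h x => by
    funext b
    change (Pi.single a ((N a).map h x) : ∀ b, (N b).V j) b =
      (N b).map h ((Pi.single a x : ∀ b, (N b).V i) b)
    by_cases hb : b = a
    · subst hb
      rw [Pi.single_eq_same, Pi.single_eq_same]
    · rw [Pi.single_eq_of_ne hb, Pi.single_eq_of_ne hb, map_zero]⟩

/-- The projection onto a summand. -/
def proj (N : Fin l → Rep k I) (a : Fin l) : Hom (directSum N) (N a) :=
  ⟨fun _ => LinearMap.proj a, fun _ _ => rfl⟩

/-- The direct sum of subrepresentations of the summands. -/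
def Sub.prod {N : Fin l → Rep k I} (W : ∀ a, Sub (N a)) : Sub (directSum N) :=
  ⟨fun i => Submodule.pi Set.univ fun a => (W a).carrier i, fun h _ hx a _ =>
    (W a).stable h _ (hx a trivial)⟩

theorem Sub.mem_prod {N : Fin l → Rep k I} {W : ∀ a, Sub (N a)} {i : I}
    {x : (directSum N).V i} :
    x ∈ (prod W).carrier i ↔ ∀ a, (proj N a).app i x ∈ (W a).carrier i :=
  ⟨fun h a => h a trivial, fun h a _ => h a⟩

theorem proj_single_same (N : Fin l → Rep k I) (a : Fin l) (i : I) (x : (N a).V i) :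
    (proj N a).app i ((single N a).app i x) = x :=
  Pi.single_eq_same (M := fun b => (N b).V i) a x

theorem proj_single_of_ne (N : Fin l → Rep k I) {a b : Fin l} (h : b ≠ a) (i : I)
    (x : (N a).V i) : (proj N b).app i ((single N a).app i x) = 0 :=
  Pi.single_eq_of_ne (M := fun b => (N b).V i) h x

theorem sum_single_proj (N : Fin l → Rep k I) (i : I) (x : (directSum N).V i) :
    ∑ a, (single N a).app i ((proj N a).app i x) = x :=
  Finset.univ_sum_single (M := fun b => (N b).V i) x

theorem Sub.comap_single_prod {N : Fin l → Rep k I} (W : ∀ a, Sub (N a)) (a : Fin l) :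
    (prod W).comap (single N a) = W a := by
  refine Sub.ext fun i x => ?_
  rw [mem_comap, mem_prod]
  refine ⟨fun h => ?_, fun h b => ?_⟩
  · have := h a
    rwa [proj_single_same] at this
  · by_cases hb : b = a
    · subst hb
      rwa [proj_single_same]
    · rw [proj_single_of_ne _ hb]
      exact zero_mem _

theorem Sub.prod_toRep_iso {N : Fin l → Rep k I} (W : ∀ a, Sub (N a)) :
    Nonempty (Iso (prod W).toRep (directSum fun a => (W a).toRep)) :=
  ⟨Iso.ofBijective
    ⟨fun i => LinearMap.pi fun a =>
      (LinearMap.proj a ∘ₗ ((prod W).carrier i).subtype).codRestrict ((W a).carrier i)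
        fun x => x.2 a trivial, fun _ _ => rfl⟩
    fun _ => ⟨fun _ _ h => Subtype.ext (funext fun a => congrArg Subtype.val (congrFun h a)),
      fun y => ⟨⟨fun a => (y a).1, fun a _ => (y a).2⟩, rfl⟩⟩⟩

theorem Sub.prod_quotient_iso {N : Fin l → Rep k I} (W : ∀ a, Sub (N a)) :
    Nonempty (Iso (prod W).quotient (directSum fun a => (W a).quotient)) := by
  refine Sub.quotient_iso_of_surjective _
    ⟨fun i => LinearMap.pi fun a => (W a).mkQ.app i ∘ₗ LinearMap.proj a, fun _ _ => rfl⟩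
    (fun i y => ?_) fun i x => ?_
  · choose x hx using fun a => (W a).mkQ_surjective i (y a)
    exact ⟨x, funext hx⟩
  · rw [mem_prod]
    exact ⟨fun h a => (W a).mkQ_eq_zero.1 (congrFun h a),
      fun h => funext fun a => (W a).mkQ_eq_zero.2 (h a)⟩

/-- Summands that vanish can be left out of a direct sum. -/
theorem directSum_reindex_iso {m : ℕ} (N : Fin l → Rep k I) (e : Fin m → Fin l)
    (he : Function.Injective e) (h : ∀ a, a ∉ Set.range e → (N a).dimVec = 0) :
    Nonempty (Iso (directSum N) (directSum fun b => N (e b))) := by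
  have hs (a : Fin l) (ha : a ∉ Set.range e) (i : I) : Subsingleton ((N a).V i) :=
    finrank_zero_iff.1 (congrFun (h a ha) i)
  refine ⟨Iso.ofBijective ⟨fun i => LinearMap.pi fun b => LinearMap.proj (e b), fun _ _ => rfl⟩
    fun i => ⟨fun x y hxy => funext fun a => ?_, fun y => ?_⟩⟩
  · by_cases ha : a ∈ Set.range e
    · obtain ⟨b, rfl⟩ := ha
      exact congrFun hxy b
    · exact (hs a ha i).elim _ _
  · refine ⟨∑ b, (single N (e b)).app i (y b), funext fun b => ?_⟩
    change (proj N (e b)).app i (∑ b, (single N (e b)).app i (y b)) = y b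
    rw [map_sum, Finset.sum_eq_single b]
    · exact proj_single_same N _ i _
    · exact fun c _ hc => proj_single_of_ne N (he.ne hc.symm) i _
    · exact fun h => absurd (Finset.mem_univ b) h

theorem dimVec_directSum (N : Fin l → Rep k I) :
    (directSum N).dimVec = ∑ a, (N a).dimVec := funext fun i => by
  rw [Finset.sum_apply]
  exact finrank_pi_fintype k

theorem Sub.dimVec_prod {N : Fin l → Rep k I} (W : ∀ a, Sub (N a)) :
    (prod W).toRep.dimVec = ∑ a, (W a).toRep.dimVec := by
  obtain ⟨e⟩ := prod_toRep_iso W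
  rw [e.dimVec_eq, dimVec_directSum]

theorem Sub.map_toRep_iso {A B : Rep k I} (e : Iso A B) (W : Sub A) :
    Nonempty (Iso W.toRep (W.map e.hom).toRep) := by
  obtain ⟨f, hf⟩ := (W.map e.hom).incl.exists_comp_eq_of_injective (e.hom.comp W.incl)
    (W.map e.hom).incl_injective fun i x => (W.map e.hom).exists_incl_eq ⟨_, W.incl_mem x, rfl⟩
  refine ⟨Iso.ofBijective f fun i => ⟨fun x y hxy => ?_, fun y => ?_⟩⟩
  · refine W.incl_injective i ((e.app i).injective ?_)
    have hx := hf i x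
    rw [hxy, hf i y] at hx
    exact hx.symm
  · obtain ⟨x, hx, hxy⟩ := (W.map e.hom).incl_mem y
    obtain ⟨x, rfl⟩ := W.exists_incl_eq hx
    exact ⟨x, (W.map e.hom).incl_injective i ((hf i x).trans hxy)⟩

theorem Sub.map_quotient_iso {A B : Rep k I} (e : Iso A B) (W : Sub A) :
    Nonempty (Iso W.quotient (W.map e.hom).quotient) := by
  refine quotient_iso_of_surjective _ ((W.map e.hom).mkQ.comp e.hom) (fun i =>
    ((W.map e.hom).mkQ_surjective i).comp (e.app i).surjective) fun i x => ?_
  rw [Hom.comp_app, mkQ_eq_zero, ← mem_comap, comap_map_of_injective fun i => (e.app i).injective]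

variable [Fintype I] [∀ i j : I, Fintype (i ⟶ j)] {δ : I → ℕ}

theorem defect_eq_sum {ι : Type*} (s : Finset ι) (B : ι → Rep k I) {A : Rep k I}
    (h : A.dimVec = ∑ a ∈ s, (B a).dimVec) : A.defect δ = ∑ a ∈ s, (B a).defect δ := by
  have := map_sum (AddMonoidHom.mk' (eulerForm I fun i => (δ i : ℤ)) (eulerForm_add_right _))
    (fun a i => ((B a).dimVec i : ℤ)) s
  simp only [AddMonoidHom.mk'_apply] at this
  rw [defect, h]
  refine Eq.trans ?_ this
  congr 1
  funext i
  simp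

theorem Sub.isReg_prod {N : Fin l → Rep k I} {W : ∀ a, Sub (N a)} (h : ∀ a, (W a).IsReg δ) :
    (prod W).IsReg δ := by
  rw [IsReg, defect_eq_sum Finset.univ _ (dimVec_prod W)]
  exact Finset.sum_eq_zero fun a _ => h a

theorem IsRegular.directSum {N : Fin l → Rep k I} (h : ∀ a, (N a).IsRegular δ) :
    (directSum N).IsRegular δ := by
  classical
  refine ⟨?_, fun V => ?_⟩
  · rw [defect_eq_sum Finset.univ _ (dimVec_directSum N)]
    exact Finset.sum_eq_zero fun a _ => (h a).1
  -- Killing one coordinate after the other only increases the defect.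
  · let Z (s : Finset (Fin l)) : Sub (Rep.directSum N) := Sub.prod fun a => if a ∈ s then ⊥ else ⊤
    have key (s : Finset (Fin l)) : V.toRep.defect δ ≤ (V ⊓ Z s).toRep.defect δ := by
      induction s using Finset.induction_on with
      | empty =>
        have : Z ∅ = ⊤ := top_le_iff.1 fun i x _ => Sub.mem_prod.2 fun a => by simp
        rw [this, inf_top_eq]
      | insert a s _ ih =>
        refine ih.trans ?_
        have e : V ⊓ Z s ⊓ (⊥ : Sub (N a)).comap (proj N a) = V ⊓ Z (insert a s) := by
          rw [inf_assoc]
          congr 1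
          refine Sub.ext fun i x => ?_
          rw [Sub.inf_carrier, Submodule.mem_inf, Sub.mem_prod, Sub.mem_prod]
          constructor
          · rintro ⟨h1, h2⟩ b
            by_cases hb : b = a
            · subst hb
              simpa using h2
            · simpa [hb] using h1 b
          · refine fun h1 => ⟨fun b => ?_, by simpa using h1 a⟩
            have := h1 b
            by_cases hb : b ∈ s
            · simpa [hb] using this
            · simp [hb]
        rw [← defect_eq_add δ ((V ⊓ Z s).dimVec_map_add (proj N a)), e]
        have := (h a).2 ((V ⊓ Z s).map (proj N a))
        omega
    refine (key Finset.univ).trans (le_of_eq ?_)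
    have : V ⊓ Z Finset.univ = ⊥ := by
      refine le_bot_iff.1 fun i x hx => (Submodule.mem_bot k).2 (funext fun a => ?_)
      have := Sub.mem_prod.1 hx.2 a
      rw [if_pos (Finset.mem_univ a)] at this
      exact this
    rw [this]
    exact Sub.isReg_bot

/-- A regular subrepresentation of a direct sum of uniserial representations of pairwise different
types is the direct sum of its intersections with the summands: if `Y` is a maximal regular
subrepresentation of `W` then `W / Y` is nonzero in at most one of the coordinates. -/
theorem Sub.eq_prod_of_isReg [Finite k] {N E : Fin l → Rep k I} {n : Fin l → ℕ}
    (hN : ∀ a, (N a).IsUniserial δ (E a) (n a))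
    (hE : ∀ a b, Nonempty (Iso (E a) (E b)) → a = b) {W : Sub (Rep.directSum N)}
    (hW : W.IsReg δ) : W = prod fun a => W.comap (single N a) := by
  have hM : (Rep.directSum N).IsRegular δ := IsRegular.directSum fun a => (hN a).isRegular
  have hle (W : Sub (Rep.directSum N)) : prod (fun a => W.comap (single N a)) ≤ W :=
    fun i x hx => by
      rw [← sum_single_proj N i x]
      exact sum_mem fun a _ => mem_prod.1 hx a
  refine le_antisymm ?_ (hle W)
  induction W using WellFoundedLT.induction with
  | ind W ih =>
    rcases (bot_le : ⊥ ≤ W).eq_or_lt with h | h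
    · exact h ▸ bot_le
    obtain ⟨Y, -, hY⟩ := exists_regCov_of_lt isReg_bot hW h
    have ihY := ih Y hY.lt hY.left
    have key (a : Fin l) (ha : ¬ W.map (proj N a) ≤ Y.comap (single N a)) :
        Nonempty (Iso (subquot Y W) (E a)) := by
      have hYa : (Y.comap (single N a)).IsReg δ := (hN a).isRegular.isReg_comap hM _ hY.left
      have hY1 : Y ≤ (Y.comap (single N a)).comap (proj N a) :=
        fun i y hy => mem_prod.1 (ihY i hy) a
      have hcase (Z : Sub (N a)) (hZ : Z.IsReg δ) (hYZ : Y.comap (single N a) ≤ Z) :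
          W ⊓ Z.comap (proj N a) = Y ∨ W ⊓ Z.comap (proj N a) = W :=
        hY.eq_or_eq _
          (hM.isReg_sup_and_inf hW (hM.isReg_comap (hN a).isRegular (proj N a) hZ)).2
          (le_inf hY.lt.le (hY1.trans (comap_mono _ hYZ))) inf_le_left
      have hP : (W.map (proj N a)).IsReg δ := hM.isReg_map (hN a).isRegular _ hW
      have hcov : RegCov δ (Y.comap (single N a)) (W.map (proj N a)) := by
        refine ⟨hYa, hP, lt_of_le_not_ge
          (((hN a).total _ _ hYa hP).resolve_right ha) ha, fun Z hZ h1 h2 => ?_⟩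
        rcases hcase Z hZ h1 with h3 | h3
        · refine Or.inl (le_antisymm (fun i z hz => ?_) h1)
          obtain ⟨w, hw, rfl⟩ := h2 i hz
          exact hY1 i (h3 ▸ (⟨hw, hz⟩ : w ∈ (W ⊓ Z.comap (proj N a)).carrier i))
        · exact Or.inr (le_antisymm h2 (map_le_iff_le_comap.2 (inf_eq_left.1 h3)))
      refine iso_trans ?_ ((hN a).iso_of_regCov _ _ hcov)
      refine subquot_iso (proj N a) (map_le_iff_le_comap.1 le_rfl)
        (fun i x hx => ⟨fun h => ?_, fun h => hY1 i h⟩) le_sup_left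
      rcases hcase _ hYa le_rfl with h3 | h3
      · exact h3 ▸ (⟨hx, h⟩ : x ∈ (W ⊓ (Y.comap (single N a)).comap (proj N a)).carrier i)
      · exact absurd (map_le_iff_le_comap.2 (inf_eq_left.1 h3)) ha
    refine fun i x hx => mem_prod.2 fun a => ?_
    by_cases ha : W.map (proj N a) ≤ Y.comap (single N a)
    · exact hY.lt.le i (ha i ⟨x, hx, rfl⟩)
    · have hb (b : Fin l) (hba : b ≠ a) :
          (single N b).app i ((proj N b).app i x) ∈ W.carrier i := by
        by_contra hb
        refine hba (hE b a (iso_trans (iso_symm (key b fun h => hb ?_)) (key a ha)))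
        exact hY.lt.le i (h i ⟨x, hx, rfl⟩)
      have hsum := sum_single_proj N i x
      rw [← Finset.add_sum_erase _ _ (Finset.mem_univ a)] at hsum
      rw [mem_comap, eq_sub_of_add_eq hsum]
      exact sub_mem hx (sum_mem fun b hb' => hb b (Finset.ne_of_mem_erase hb'))

/-- `M` is isomorphic to a direct sum of uniserial representations of types `E a` and regular
lengths `ν a`. -/
def IsOfType (δ : I → ℕ) (E : Fin l → Rep k I) (ν : Fin l → ℕ) (M : Rep k I) : Prop :=
  ∃ N : Fin l → Rep k I, (∀ a, (N a).IsUniserial δ (E a) (ν a)) ∧ Nonempty (Iso M (directSum N))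

theorem IsOfType.of_iso {E : Fin l → Rep k I} {ν : Fin l → ℕ} {M M' : Rep k I}
    (h : M.IsOfType δ E ν) (e : Nonempty (Iso M' M)) : M'.IsOfType δ E ν := by
  obtain ⟨N, hN, hMN⟩ := h
  exact ⟨N, hN, iso_trans e hMN⟩

theorem IsOfType.dimVec_eq {E : Fin l → Rep k I} {ν : Fin l → ℕ} {M : Rep k I}
    (h : M.IsOfType δ E ν) (hd : ∀ a, (E a).dimVec = δ) : M.dimVec = (∑ a, ν a) • δ := by
  obtain ⟨N, hN, ⟨e⟩⟩ := h
  rw [e.dimVec_eq, dimVec_directSum, Finset.sum_smul]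
  exact Finset.sum_congr rfl fun a _ => by rw [(hN a).dimVec_eq, hd]

theorem IsOfType.isRegular {E : Fin l → Rep k I} {ν : Fin l → ℕ} {M : Rep k I}
    (h : M.IsOfType δ E ν) : M.IsRegular δ := by
  obtain ⟨N, hN, e⟩ := h
  exact (IsRegular.directSum fun a => (hN a).isRegular).of_iso (iso_symm e)

/-- The regular subrepresentations of a direct sum of uniserial representations from different
tubes correspond to the families of smaller lengths. -/
theorem IsOfType.exists_equiv [Finite k] {E : Fin l → Rep k I} {ν : Fin l → ℕ} {M : Rep k I}
    (hM : M.IsOfType δ E ν) (hs : ∀ a, (E a).IsRegularSimple δ)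
    (hE : ∀ a b, Nonempty (Iso (E a) (E b)) → a = b) :
    ∃ Φ : {W : Sub M // W.IsReg δ} ≃ {β : Fin l → ℕ // β ≤ ν},
      ∀ W : {W : Sub M // W.IsReg δ},
      W.1.toRep.IsOfType δ E (Φ W).1 ∧ W.1.quotient.IsOfType δ E (ν - (Φ W).1) := by
  have hMr := hM.isRegular
  obtain ⟨N, hN, ⟨e⟩⟩ := hM
  have hDr : (directSum N).IsRegular δ := IsRegular.directSum fun a => (hN a).isRegular
  have hex (a : Fin l) (V : Sub (N a)) (hV : V.IsReg δ) :
      ∃ j, j ≤ ν a ∧ V.toRep.dimVec = j • (E a).dimVec := by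
    obtain ⟨j, hj⟩ := (hN a).exists_dimVec_eq hV
    refine ⟨j, ?_, hj⟩
    obtain ⟨i, hi⟩ := Function.ne_iff.1 (hs a).dimVec_ne_zero
    have h1 : V.toRep.dimVec i ≤ (N a).dimVec i := (V.carrier i).finrank_le
    rw [hj, (hN a).dimVec_eq] at h1
    exact Nat.le_of_mul_le_mul_right h1 (Nat.pos_of_ne_zero hi)
  have hsub (W : {W : Sub M // W.IsReg δ}) (a : Fin l) :
      ((W.1.map e.hom).comap (single N a)).IsReg δ :=
    (hN a).isRegular.isReg_comap hDr _ (hMr.isReg_map hDr e.hom W.2)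
  choose Φ hΦle hΦ using fun (W : {W : Sub M // W.IsReg δ}) (a : Fin l) => hex a _ (hsub W a)
  have hW (W : {W : Sub M // W.IsReg δ}) :=
    Sub.eq_prod_of_isReg hN hE (hMr.isReg_map hDr e.hom W.2)
  refine ⟨Equiv.ofBijective (fun W => ⟨Φ W, hΦle W⟩) ⟨fun W W' h => ?_, fun β => ?_⟩,
    fun W => ⟨?_, ?_⟩⟩
  · have h' : Φ W = Φ W' := congrArg Subtype.val h
    refine Subtype.ext ?_
    rw [← Sub.comap_map_of_injective (f := e.hom) (fun i => (e.app i).injective) W.1,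
      ← Sub.comap_map_of_injective (f := e.hom) (fun i => (e.app i).injective) W'.1,
      hW W, hW W']
    congr 2
    funext a
    exact (hN a).eq_of_dimVec_eq (hsub W a) (hsub W' a) (by rw [hΦ, hΦ, h'])
  · choose V hV hVd using fun a => (hN a).toIsPure.exists_sub_dimVec_eq (hs a) (j := β.1 a)
      (m := ν a - β.1 a) (by rw [(hN a).dimVec_eq, Nat.add_sub_of_le (β.2 a)])
    refine ⟨⟨(Sub.prod V).comap e.hom, hMr.isReg_comap hDr e.hom (Sub.isReg_prod hV)⟩,
      Subtype.ext (funext fun a => ?_)⟩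
    have := hΦ ⟨(Sub.prod V).comap e.hom, hMr.isReg_comap hDr e.hom (Sub.isReg_prod hV)⟩ a
    simp only at this
    rw [Sub.map_comap_of_surjective (fun i => (e.app i).surjective), Sub.comap_single_prod,
      hVd] at this
    exact (smul_dimVec_injective (hs a).dimVec_ne_zero this).symm
  · refine ⟨fun a => ((W.1.map e.hom).comap (single N a)).toRep,
      fun a => (hN a).toRep (hsub W a) (hΦ W a), iso_trans (Sub.map_toRep_iso e W.1) ?_⟩
    have := Sub.prod_toRep_iso fun a => (W.1.map e.hom).comap (single N a)
    rwa [← hW W] at this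
  · refine ⟨fun a => ((W.1.map e.hom).comap (single N a)).quotient,
      fun a => (hN a).quotient (hsub W a) (hΦ W a) (Nat.sub_add_cancel (hΦle W a)),
      iso_trans (Sub.map_quotient_iso e W.1) ?_⟩
    have := Sub.prod_quotient_iso fun a => (W.1.map e.hom).comap (single N a)
    rwa [← hW W] at this

end Rep

end DirectSum

open scoped Classical

/-! ### Complete homogeneous symmetric polynomials -/

section CompleteHomogeneous

open MvPolynomial

/-- The complete homogeneous symmetric polynomial of degree `m` in the first `n` variables; it is
zero for `m < 0`. -/
noncomputable def hpoly (n : ℕ) (m : ℤ) : MvPolynomial ℕ ℤ :=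
  if 0 ≤ m then ∑ α ∈ Finset.finsuppAntidiag (Finset.range n) m.toNat, monomial α 1 else 0

theorem coeff_hpoly (n : ℕ) (m : ℤ) (α : ℕ →₀ ℕ) : coeff α (hpoly n m) =
    if (∀ i, n ≤ i → α i = 0) ∧ ((∑ i ∈ Finset.range n, α i : ℕ) : ℤ) = m then 1 else 0 := by
  have hsupp (β : ℕ →₀ ℕ) : β.support ⊆ Finset.range n ↔ ∀ i, n ≤ i → β i = 0 := by
    refine forall_congr' fun i => ?_
    rw [Finsupp.mem_support_iff, Finset.mem_range]
    constructor <;> intro h <;> by_contra! h' <;> omega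
  unfold hpoly
  split_ifs with h1 h2 h2
  · rw [coeff_sum, Finset.sum_eq_single α]
    · rw [coeff_monomial, if_pos rfl]
    · exact fun β _ hβ => by rw [coeff_monomial, if_neg hβ]
    · refine fun h => absurd (Finset.mem_finsuppAntidiag.2 ⟨?_, (hsupp α).2 h2.1⟩) h
      change ∑ i ∈ Finset.range n, α i = _
      omega
  · rw [coeff_sum]
    refine Finset.sum_eq_zero fun β hβ => ?_
    rw [coeff_monomial, if_neg]
    rintro rfl
    obtain ⟨h3, h4⟩ := Finset.mem_finsuppAntidiag.1 hβ
    change ∑ i ∈ Finset.range n, β i = _ at h3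
    exact h2 ⟨(hsupp β).1 h4, by omega⟩
  · omega
  · exact coeff_zero _

/-- The extension by zero of an exponent vector. -/
noncomputable def extendFin {l : ℕ} (β : Fin l → ℕ) : ℕ →₀ ℕ :=
  Finsupp.onFinset (Finset.range l) (fun i => if h : i < l then β ⟨i, h⟩ else 0) fun i hi => by
    by_contra h
    exact hi (dif_neg fun h' => h (Finset.mem_range.2 h'))

theorem extendFin_apply {l : ℕ} (β : Fin l → ℕ) (a : Fin l) : extendFin β a = β a :=
  dif_pos a.2

theorem extendFin_of_le {l : ℕ} (β : Fin l → ℕ) {i : ℕ} (h : l ≤ i) : extendFin β i = 0 :=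
  dif_neg h.not_gt

theorem extendFin_restrict {l : ℕ} {α : ℕ →₀ ℕ} (h : ∀ i, l ≤ i → α i = 0) :
    extendFin (fun a : Fin l => α a) = α := by
  ext i
  rcases lt_or_ge i l with hi | hi
  · exact extendFin_apply (fun a : Fin l => α a) ⟨i, hi⟩
  · rw [extendFin_of_le _ hi, h i hi]

theorem extendFin_add {l : ℕ} (β γ : Fin l → ℕ) :
    extendFin (β + γ) = extendFin β + extendFin γ := by
  ext i
  rcases lt_or_ge i l with hi | hi
  · rw [Finsupp.add_apply]
    exact (extendFin_apply (β + γ) ⟨i, hi⟩).trans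
      (congrArg₂ _ (extendFin_apply β ⟨i, hi⟩).symm (extendFin_apply γ ⟨i, hi⟩).symm)
  · simp [extendFin_of_le _ hi]

theorem extendFin_injective {l : ℕ} : Function.Injective (extendFin (l := l)) := fun β γ h =>
  funext fun a => by rw [← extendFin_apply β, h, extendFin_apply]

theorem coeff_extendFin_hpoly {l : ℕ} (β : Fin l → ℕ) (m : ℤ) :
    coeff (extendFin β) (hpoly l m) = if ((∑ a, β a : ℕ) : ℤ) = m then 1 else 0 := by
  rw [coeff_hpoly, Finset.sum_range]
  simp only [extendFin_apply]
  exact if_congr (and_iff_right fun i hi => extendFin_of_le β hi) rfl rfl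

theorem coeff_extendFin_mul {l : ℕ} (ν : Fin l → ℕ) [Fintype {β : Fin l → ℕ // β ≤ ν}]
    (p q : MvPolynomial ℕ ℤ) : coeff (extendFin ν) (p * q) =
      ∑ β : {β : Fin l → ℕ // β ≤ ν}, coeff (extendFin (ν - β.1)) p * coeff (extendFin β.1) q := by
  rw [coeff_mul]
  symm
  refine Finset.sum_bij (fun β _ => (extendFin (ν - β.1), extendFin β.1)) (fun β _ => ?_)
    (fun β _ γ _ h => Subtype.ext (extendFin_injective (congrArg Prod.snd h)))
    (fun x hx => ?_) fun _ _ => rfl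
  · rw [Finset.HasAntidiagonal.mem_antidiagonal, ← extendFin_add, tsub_add_cancel_of_le β.2]
  · rw [Finset.HasAntidiagonal.mem_antidiagonal] at hx
    have hsum (i : ℕ) : x.1 i + x.2 i = extendFin ν i := by rw [← hx, Finsupp.add_apply]
    have hz (i : ℕ) (hi : l ≤ i) : x.1 i = 0 ∧ x.2 i = 0 := by
      have := hsum i
      rw [extendFin_of_le _ hi] at this
      omega
    have hν (a : Fin l) : x.1 a + x.2 a = ν a := by rw [hsum, extendFin_apply]
    refine ⟨⟨fun a => x.2 a, fun a => ?_⟩, Finset.mem_univ _, Prod.ext ?_ ?_⟩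
    · have := hν a
      change x.2 a ≤ ν a
      omega
    · refine Eq.trans ?_ (extendFin_restrict (l := l) fun i hi => (hz i hi).1)
      change extendFin _ = _
      congr 1
      funext a
      have := hν a
      change ν a - x.2 a = x.1 a
      omega
    · exact extendFin_restrict fun i hi => (hz i hi).2

end CompleteHomogeneous

/-! ### Homogeneous tubes of degree one -/

section TubesOfDegreeOne

variable {k : Type u} [Field k]
  {I : Type w} [Quiver.{v} I] [Fintype I] [∀ i j : I, Fintype (i ⟶ j)] {δ : I → ℕ}

/-- The regular simple representation at the mouth of a homogeneous tube. -/
noncomputable def HomogeneousTube.simple (z : HomogeneousTube k δ) : Rep k I := z.mouth.rep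

theorem HomogeneousTube.isoClass_simple (z : HomogeneousTube k δ) : isoClass z.simple = z.mouth :=
  z.mouth.isoClass_rep

theorem HomogeneousTube.isRegularSimple (z : HomogeneousTube k δ) :
    z.simple.IsRegularSimple δ := by
  obtain ⟨E, hE, hs, -⟩ := z.exists_rep
  exact hs.of_iso (isoClass_eq_iff.1 (hE.trans z.isoClass_simple.symm))

theorem HomogeneousTube.dimVec_simple {z : HomogeneousTube k δ} (hz : z.HasDegree 1) :
    z.simple.dimVec = δ := by
  rw [← dimVec_isoClass, z.isoClass_simple, hz, one_smul]

theorem HomogeneousTube.isIndecomposableOfLength_iff [Finite k] {z : HomogeneousTube k δ}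
    (hz : z.HasDegree 1)
    (hδ : eulerForm I (fun i => (δ i : ℤ)) (fun i => (δ i : ℤ)) = 0) {n : ℕ} {M : Rep k I} :
    z.IsIndecomposableOfLength n M ↔ n ≠ 0 ∧ M.IsUniserial δ z.simple n := by
  have hs := z.isRegularSimple
  unfold IsIndecomposableOfLength
  rw [← z.isoClass_simple]
  constructor
  · rintro ⟨h1, h2⟩
    refine ⟨?_, (h2.isPure hs).isUniserial hs ?_ h1 h2.dimVec_eq⟩
    · rintro rfl
      obtain ⟨i, hi⟩ := h1.1
      have h2 : ∀ i, Subsingleton (M.V i) := h2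
      exact not_subsingleton (M.V i) (h2 i)
    · rw [dimVec_simple hz, hδ]
  · rintro ⟨h1, h2⟩
    exact ⟨h2.indecomposable hs h1, h2.toIsPure.hasFiltration hs h2.dimVec_eq⟩

variable {l : ℕ} {z : Fin l → HomogeneousTube k δ}

theorem simple_iso_injective (hz : Function.Injective z) (a b : Fin l)
    (h : Nonempty (Rep.Iso (z a).simple (z b).simple)) : a = b := by
  refine hz (HomogeneousTube.ext ?_)
  rw [← (z a).isoClass_simple, ← (z b).isoClass_simple]
  exact isoClass_eq_iff.2 h

theorem Rep.IsOfType.isHomogeneousRegular [Finite k] (hdeg : ∀ a, (z a).HasDegree 1)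
    (hδ : eulerForm I (fun i => (δ i : ℤ)) (fun i => (δ i : ℤ)) = 0) {ν : Fin l → ℕ}
    {M : Rep k I} (hM : M.IsOfType δ (fun a => (z a).simple) ν) :
    (isoClass M).IsHomogeneousRegular δ := by
  obtain ⟨N, hN, hMN⟩ := hM
  let s : Finset (Fin l) := Finset.univ.filter fun a => ν a ≠ 0
  let e : Fin s.card → Fin l := fun b => (s.equivFin.symm b).1
  refine ⟨s.card, fun b => N (e b), fun b => ⟨z (e b), ν (e b), ?_⟩, ?_⟩
  · rw [HomogeneousTube.isIndecomposableOfLength_iff (hdeg _) hδ]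
    exact ⟨(Finset.mem_filter.1 (s.equivFin.symm b).2).2, hN _⟩
  · refine isoClass_eq_iff.2 (Rep.iso_symm (Rep.iso_trans hMN (Rep.directSum_reindex_iso N e
      (Subtype.val_injective.comp s.equivFin.symm.injective) fun a ha => ?_)))
    have : ν a = 0 := by
      by_contra h
      exact ha ⟨s.equivFin ⟨a, Finset.mem_filter.2 ⟨Finset.mem_univ _, h⟩⟩, by simp [e]⟩
    rw [(hN a).dimVec_eq, this, zero_smul]

end TubesOfDegreeOne

/-! ### Coefficients of products in the Hall algebra -/

section HallCoefficients

variable {k : Type u} [Field k] [Fintype k] {I : Type w} [Quiver.{v} I]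

theorem vq_ne_zero : vq k ≠ 0 := fun h => by
  have h1 : ((Real.sqrt (Fintype.card k) : ℝ) : ℂ) = 0 := congrArg Subtype.val h
  rw [Complex.ofReal_eq_zero, Real.sqrt_eq_zero (Nat.cast_nonneg _), Nat.cast_eq_zero] at h1
  exact Fintype.card_ne_zero h1

/-- The coefficient of a basis element as a linear form. -/
noncomputable def HallAlgebra.coeffHom (L : IsoClass k I) : HallAlgebra k I →ₗ[QSqrt k] QSqrt k :=
  (Finsupp.lapply L : (IsoClass k I →₀ QSqrt k) →ₗ[QSqrt k] QSqrt k)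

theorem HallAlgebra.coeffHom_apply (L : IsoClass k I) (x : HallAlgebra k I) :
    HallAlgebra.coeffHom L x = x.coeff L := rfl

theorem coeff_one (X : IsoClass k I) :
    (1 : HallAlgebra k I).coeff X = if X = isoClass Rep.zero then 1 else 0 := by
  change (Finsupp.single (isoClass Rep.zero) (1 : QSqrt k) : IsoClass k I →₀ QSqrt k) X = _
  rw [Finsupp.single_apply]
  exact if_congr eq_comm rfl rfl

variable [Fintype I]

noncomputable instance (L : Rep k I) : Fintype (Rep.Sub L) := Fintype.ofFinite _

theorem hallNumber_eq_sum (L M N : IsoClass k I) : (hallNumber L M N : QSqrt k) =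
    ∑ W : Rep.Sub L.rep, if M = isoClass W.quotient then
      (if N = isoClass W.toRep then 1 else 0) else 0 := by
  rw [hallNumber, Nat.card_eq_fintype_card, Fintype.card_subtype, Finset.card_filter]
  push_cast
  refine Finset.sum_congr rfl fun W _ => ?_
  rw [← ite_and]
  refine if_congr ?_ rfl rfl
  rw [and_comm, eq_comm (a := M), eq_comm (a := N)]

variable [∀ i j : I, Fintype (i ⟶ j)] {δ : I → ℕ}

/-- A coefficient of a product as a sum over subrepresentations. -/
theorem HallAlgebra.coeff_mul (x y : HallAlgebra k I) (L : IsoClass k I) :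
    (x * y).coeff L = ∑ W : Rep.Sub L.rep,
      x.coeff (isoClass W.quotient) * y.coeff (isoClass W.toRep) *
        vq k ^ eulerForm I (fun i => (W.quotient.dimVec i : ℤ))
          (fun i => (W.toRep.dimVec i : ℤ)) := by
  have hb (M N : IsoClass k I) : HallAlgebra.coeffHom L (basisMul M N) =
      vq k ^ eulerForm I (fun i => (M.dimVec i : ℤ)) (fun i => (N.dimVec i : ℤ)) *
        (hallNumber L M N : QSqrt k) := rfl
  have hx : x * y = (show IsoClass k I →₀ QSqrt k from x).sum fun M a =>
    (show IsoClass k I →₀ QSqrt k from y).sum fun N b => (a * b) • basisMul M N := rfl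
  rw [← HallAlgebra.coeffHom_apply, hx]
  simp only [Finsupp.sum, map_sum, map_smul, hb, hallNumber_eq_sum, Finset.mul_sum, smul_eq_mul,
    mul_ite, mul_one, mul_zero]
  have hswap (M : IsoClass k I) := Finset.sum_comm (s := Finsupp.support (show _ →₀ QSqrt k from y))
    (t := (Finset.univ : Finset (Rep.Sub L.rep))) (f := fun N W =>
      if M = isoClass W.quotient then (if N = isoClass W.toRep then
        ((show IsoClass k I →₀ QSqrt k from x) M * (show IsoClass k I →₀ QSqrt k from y) N *
          vq k ^ eulerForm I (fun i => (M.dimVec i : ℤ))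
            (fun i => (N.dimVec i : ℤ))) else 0) else 0)
  rw [Finset.sum_congr rfl fun M _ => hswap M, Finset.sum_comm]
  refine Finset.sum_congr rfl fun W _ => ?_
  by_cases h1 : x.coeff (isoClass W.quotient) = 0
  · rw [h1, zero_mul, zero_mul]
    refine Finset.sum_eq_zero fun M _ => Finset.sum_eq_zero fun N _ => ?_
    split_ifs with h2
    · rw [h2]
      change HallAlgebra.coeff x _ * _ * _ = 0
      rw [h1, zero_mul, zero_mul]
    · rfl
    · rfl
  by_cases h2 : y.coeff (isoClass W.toRep) = 0
  · rw [h2, mul_zero, zero_mul]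
    refine Finset.sum_eq_zero fun M _ => Finset.sum_eq_zero fun N _ => ?_
    split_ifs with h3 h4
    · rw [h4]
      change _ * HallAlgebra.coeff y _ * _ = 0
      rw [h2, mul_zero, zero_mul]
    · rfl
    · rfl
  rw [Finset.sum_eq_single (isoClass W.quotient), Finset.sum_eq_single (isoClass W.toRep),
    if_pos rfl, if_pos rfl]
  · rfl
  · exact fun N _ hN => by rw [if_pos rfl, if_neg hN]
  · exact fun h => absurd (Finsupp.mem_support_iff.2 h2) h
  · exact fun M _ hM => Finset.sum_eq_zero fun N _ => if_neg hM
  · exact fun h => absurd (Finsupp.mem_support_iff.2 h1) h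

theorem coeff_hallH (m : ℕ) (X : IsoClass k I) : (hallH k δ m).coeff X =
    if X.IsHomogeneousRegular δ ∧ X.dimVec = m • δ then
      vq k ^ (-((∑ i, X.dimVec i : ℕ) : ℤ)) else 0 := rfl

variable {l : ℕ} {z : Fin l → HomogeneousTube k δ}

/-- The coefficient of a product of elements `H_m` at a direct sum of uniserial representations
from different tubes of degree one counts chains of regular subrepresentations, that is, chains of
exponent vectors; so it is a coefficient of the product of the polynomials `hpoly`. -/
theorem coeff_prod_hallHInt (hz : Function.Injective z) (hdeg : ∀ a, (z a).HasDegree 1)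
    (hδ : eulerForm I (fun i => (δ i : ℤ)) (fun i => (δ i : ℤ)) = 0) (hδ0 : δ ≠ 0)
    (ms : List ℤ) {ν : Fin l → ℕ} {M : Rep k I}
    (hM : M.IsOfType δ (fun a => (z a).simple) ν) :
    (ms.map (hallHInt k δ)).prod.coeff (isoClass M) =
      vq k ^ (-(ms.sum * (∑ i, δ i : ℕ))) *
        ((MvPolynomial.coeff (extendFin ν) (ms.map (hpoly l)).prod : ℤ) : QSqrt k) := by
  have hd (a : Fin l) : (z a).simple.dimVec = δ := HomogeneousTube.dimVec_simple (hdeg a)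
  induction ms generalizing ν M with
  | nil =>
    rw [List.map_nil, List.prod_nil, List.map_nil, List.prod_nil, coeff_one,
      MvPolynomial.coeff_one, List.sum_nil, zero_mul, neg_zero, zpow_zero, one_mul, Int.cast_ite,
      Int.cast_one, Int.cast_zero]
    have hdim := hM.dimVec_eq hd
    refine if_congr ⟨fun h => ?_, fun h => ?_⟩ rfl rfl
    · obtain ⟨e⟩ := isoClass_eq_iff.1 h
      have h0 : (∑ a, ν a) • δ = 0 := by
        rw [← hdim, e.dimVec_eq]
        refine funext fun i => ?_
        change Module.finrank k PUnit.{u + 1} = 0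
        exact Module.finrank_zero_of_subsingleton
      have h1 := (smul_eq_zero.1 h0).resolve_right hδ0
      have h2 : ν = 0 := funext fun a => Finset.sum_eq_zero_iff.1 h1 a (Finset.mem_univ _)
      ext i
      rcases lt_or_ge i l with hi | hi
      · exact ((extendFin_apply ν ⟨i, hi⟩).trans (congrFun h2 _)).symm
      · exact (extendFin_of_le ν hi).symm
    · have h2 (a : Fin l) : ν a = 0 := by rw [← extendFin_apply ν, ← h]; rfl
      rw [Finset.sum_eq_zero fun a _ => h2 a, zero_smul] at hdim
      have hs (i : I) : Subsingleton (M.V i) := Module.finrank_zero_iff.1 (congrFun hdim i)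
      have hs' (i : I) : Subsingleton ((Rep.zero : Rep k I).V i) :=
        inferInstanceAs (Subsingleton PUnit)
      exact isoClass_eq_iff.2 ⟨⟨fun i => 0, fun _ _ => Subsingleton.elim _ _⟩⟩
  | cons m ms ih =>
    rw [List.map_cons, List.prod_cons, List.map_cons, List.prod_cons, HallAlgebra.coeff_mul,
      List.sum_cons]
    have hL := hM.of_iso (isoClass_eq_iff.1 (isoClass M).isoClass_rep)
    obtain ⟨Φ, hΦ⟩ := hL.exists_equiv (fun a => (z a).isRegularSimple) (simple_iso_injective hz)
    let _ : Fintype {β : Fin l → ℕ // β ≤ ν} := Fintype.ofEquiv _ Φ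
    rw [coeff_extendFin_mul, Int.cast_sum, Finset.mul_sum, ← Φ.sum_comp]
    -- The quotient by a subrepresentation of nonzero defect has no coefficient in `H_m`.
    have hnonreg (W : Rep.Sub (isoClass M).rep) (hW : ¬ W.IsReg δ) :
        (hallHInt k δ m).coeff (isoClass W.quotient) = 0 := by
      unfold hallHInt
      split_ifs with hm
      · rw [coeff_hallH, if_neg]
        rintro ⟨-, h⟩
        refine hW ?_
        have h1 := Rep.defect_eq_add δ (congrFun W.dimVec_quotient_add)
        have h2 : W.quotient.defect δ = 0 := by
          have : (fun i => (W.quotient.dimVec i : ℤ)) = (m.toNat : ℤ) • fun i => (δ i : ℤ) := by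
            funext i
            rw [← dimVec_isoClass, h]
            simp
          rw [Rep.defect, this]
          have := eulerForm_smul_smul 1 m.toNat (fun i => (δ i : ℤ)) (fun i => (δ i : ℤ))
          rw [hδ, mul_zero, one_smul] at this
          exact this
        rw [h2, zero_add, hL.isRegular.1] at h1
        exact h1
      · rfl
    rw [← Finset.sum_subset (Finset.subset_univ (Finset.univ.filter fun W : Rep.Sub _ =>
      W.IsReg δ)) fun W _ hW => by
        rw [hnonreg W fun h => hW (Finset.mem_filter.2 ⟨Finset.mem_univ _, h⟩), zero_mul, zero_mul],
      Finset.sum_subtype (p := fun W : Rep.Sub _ => W.IsReg δ) _ fun W => by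
        simp]
    refine Finset.sum_congr rfl fun W _ => ?_
    obtain ⟨hW, hQ⟩ := hΦ W
    have hQdim := hQ.dimVec_eq hd
    have hWdim := hW.dimVec_eq hd
    have hcast (n : ℕ) : (fun i => ((n • δ) i : ℤ)) = (n : ℤ) • fun i => (δ i : ℤ) := by
      funext i
      simp
    rw [ih hW, hQdim, hWdim, hcast, hcast, eulerForm_smul_smul, hδ, mul_zero, zpow_zero, mul_one,
      coeff_extendFin_hpoly]
    have hcoeff : (hallHInt k δ m).coeff (isoClass W.1.quotient) =
        if ((∑ a, (ν - (Φ W).1) a : ℕ) : ℤ) = m then vq k ^ (-(m * (∑ i, δ i : ℕ))) else 0 := by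
      unfold hallHInt
      split_ifs with h1 h2 h2
      · have hX : (isoClass W.1.quotient).dimVec = m.toNat • δ := by
          rw [dimVec_isoClass, hQdim]
          congr 1
          omega
        rw [coeff_hallH, if_pos ⟨hQ.isHomogeneousRegular hdeg hδ, hX⟩, hX]
        congr 2
        simp only [Pi.smul_apply, smul_eq_mul, ← Finset.mul_sum, Nat.cast_mul]
        rw [Int.toNat_of_nonneg h1]
      · rw [coeff_hallH, if_neg]
        rintro ⟨-, h⟩
        rw [dimVec_isoClass, hQdim] at h
        have := Rep.smul_dimVec_injective hδ0 h
        omega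
      · omega
      · rfl
    rw [hcoeff]
    split_ifs
    · rw [one_mul, add_mul, neg_add, zpow_add₀ vq_ne_zero, mul_assoc]
    · rw [zero_mul, zero_mul, Int.cast_zero, mul_zero]

end HallCoefficients

/-! ### The Jacobi--Trudi formula -/

section JacobiTrudi

open MvPolynomial Finset

theorem hpoly_of_neg (n : ℕ) {m : ℤ} (h : m < 0) : hpoly n m = 0 := if_neg h.not_ge

theorem hpoly_zero (m : ℤ) : hpoly 0 m = if m = 0 then 1 else 0 := by
  ext α
  rw [coeff_hpoly]
  have h : (∀ i, 0 ≤ i → α i = 0) ↔ 0 = α :=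
    ⟨fun h => (Finsupp.ext fun i => h i i.zero_le).symm, fun h i _ => by rw [← h]; rfl⟩
  rw [h, sum_range_zero, Nat.cast_zero]
  by_cases h1 : m = 0
  · simp [h1, MvPolynomial.coeff_one]
  · simp [h1, Ne.symm h1]

theorem hpoly_succ (n : ℕ) (m : ℤ) : hpoly (n + 1) m = hpoly n m + X n * hpoly (n + 1) (m - 1) := by
  ext α
  rw [coeff_add, coeff_X_mul', coeff_hpoly, coeff_hpoly, coeff_hpoly]
  rcases eq_or_ne (α n) 0 with h | h
  · rw [if_neg (show n ∉ α.support by simp [h]), add_zero]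
    refine if_congr ?_ rfl rfl
    rw [sum_range_succ, h, add_zero]
    refine and_congr_left fun _ => ⟨fun h1 i hi => ?_, fun h1 i hi => h1 i (by omega)⟩
    rcases hi.eq_or_lt with rfl | hi
    · exact h
    · exact h1 i hi
  · rw [if_pos (Finsupp.mem_support_iff.2 h),
      if_neg (c := (∀ i, n ≤ i → α i = 0) ∧ _) fun h1 => h (h1.1 n le_rfl), zero_add]
    have hlt (i : ℕ) (hi : i ≠ n) : (α - Finsupp.single n 1 : ℕ →₀ ℕ) i = α i := by
      rw [Finsupp.tsub_apply, Finsupp.single_apply, if_neg hi.symm, tsub_zero]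
    have hn : (α - Finsupp.single n 1 : ℕ →₀ ℕ) n = α n - 1 := by
      rw [Finsupp.tsub_apply, Finsupp.single_apply, if_pos rfl]
    refine if_congr (and_congr (forall_congr' fun i => imp_congr_right fun hi => ?_) ?_) rfl rfl
    · rw [hlt i (by omega)]
    · rw [sum_range_succ, sum_range_succ, hn,
        sum_congr rfl fun i hi => hlt i (Finset.mem_range.1 hi).ne]
      change ((∑ i ∈ range n, α i + α n : ℕ) : ℤ) = m ↔
        ((∑ i ∈ range n, α i + (α n - 1) : ℕ) : ℤ) = m - 1
      omega

theorem hpoly_succ_eq_sum (n t : ℕ) (m : ℤ) : hpoly (n + 1) m =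
    ∑ j ∈ range t, X n ^ j * hpoly n (m - j) + X n ^ t * hpoly (n + 1) (m - t) := by
  induction t with
  | zero => simp
  | succ t ih =>
    rw [ih, hpoly_succ n (m - t), sum_range_succ, sub_sub, Nat.cast_succ]
    ring

variable {s : ℕ}

/-- The Jacobi--Trudi determinant in the first `n` variables for the row lengths `q`. -/
noncomputable def jacobiTrudi (n : ℕ) (q : Fin s → ℕ) : MvPolynomial ℕ ℤ :=
  Matrix.det (Matrix.of fun a b : Fin s => hpoly n ((q a : ℤ) - a + b))

theorem coeff_jacobiTrudi_eq_zero {n : ℕ} {q : Fin s → ℕ} {α : ℕ →₀ ℕ} {i : ℕ} (hi : n ≤ i)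
    (hα : α i ≠ 0) : coeff α (jacobiTrudi n q) = 0 := by
  have hh (m : ℤ) : hpoly n m ∈ supported ℤ (Set.Iio n) := by
    rw [mem_supported]
    intro j hj
    obtain ⟨β, hβ, hjβ⟩ := (mem_vars_iff_mem_support j).1 hj
    rw [mem_support_iff, coeff_hpoly] at hβ
    by_contra hjn
    refine hβ (if_neg fun h => ?_)
    exact Finsupp.mem_support_iff.1 hjβ (h.1 j (not_lt.1 hjn))
  have hdet : jacobiTrudi n q ∈ supported ℤ (Set.Iio n) := by
    rw [jacobiTrudi, Matrix.det_apply]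
    exact sum_mem fun σ _ => by
      rw [Units.smul_def]
      exact zsmul_mem (prod_mem fun a _ => hh _) _
  by_contra h
  have : i ∈ (jacobiTrudi n q).vars :=
    (mem_vars_iff_mem_support i).2 ⟨α, mem_support_iff.2 h, Finsupp.mem_support_iff.2 hα⟩
  exact absurd (mem_supported.1 hdet this) (not_lt.2 hi)

/-- The branching rule for the Jacobi--Trudi determinant. Subtracting from each row a multiple of
the next one leaves in row `a` the sum over the `q a` between `r (a + 1)` and `r a`, and the
determinant is multilinear in the rows. -/
theorem jacobiTrudi_succ (n : ℕ) {r : ℕ → ℕ} (hr : Antitone r) (hs : r s = 0) :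
    jacobiTrudi (n + 1) (fun a : Fin s => r a) =
      ∑ q ∈ Fintype.piFinset fun a : Fin s => Icc (r (a + 1)) (r a),
        X n ^ (∑ a : Fin s, (r a - q a)) * jacobiTrudi n q := by
  let t (a : ℕ) : ℕ := r a - r (a + 1) + 1
  let A : Matrix (Fin s) (Fin s) (MvPolynomial ℕ ℤ) :=
    Matrix.of fun a b => hpoly (n + 1) ((r a : ℤ) - a + b)
  let B : Matrix (Fin s) (Fin s) (MvPolynomial ℕ ℤ) :=
    Matrix.of fun a c => if a = c then 1 else if (c : ℕ) = a + 1 then -X n ^ t a else 0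
  have hB' (a c : Fin s) :
      B a c = if a = c then 1 else if (c : ℕ) = a + 1 then -X n ^ t a else 0 := rfl
  have hB : B.det = 1 := by
    rw [Matrix.det_of_isUpperTriangular]
    · exact prod_eq_one fun a _ => if_pos rfl
    · intro a c hca
      have hca : c < a := hca
      change (if a = c then (1 : MvPolynomial ℕ ℤ) else _) = 0
      rw [if_neg hca.ne', if_neg]
      have : (c : ℕ) < a := hca
      omega
  have hBA (a b : Fin s) : (B * A) a b =
      ∑ p ∈ Icc (r (a + 1)) (r a), X n ^ (r a - p) * hpoly n ((p : ℤ) - a + b) := by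
    have h1 : (B * A) a b = A a b - X n ^ t a * hpoly (n + 1) ((r a : ℤ) - a + b - t a) := by
      have ht : (r a : ℤ) - a + b - t a = r (a + 1) - (a + 1 : ℕ) + b := by
        have := hr (Nat.le_succ a)
        simp only [t, Nat.succ_eq_add_one] at *
        push_cast [this]
        ring
      rw [Matrix.mul_apply, ← add_sum_erase _ _ (mem_univ a), ht, sub_eq_add_neg]
      congr 1
      · rw [show B a a = 1 from if_pos rfl, one_mul]
      · by_cases ha : (a : ℕ) + 1 < s
        · rw [sum_eq_single_of_mem ⟨a + 1, ha⟩ (mem_erase.2 ⟨fun h => by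
            have := congrArg Fin.val h
            simp at this, mem_univ _⟩)]
          · rw [show B a ⟨a + 1, ha⟩ = -X n ^ t a from by
              rw [hB', if_neg fun h => by
                have := congrArg Fin.val h
                simp at this, if_pos rfl], neg_mul]
            rfl
          · intro c hc hc'
            rw [show B a c = 0 from by
              rw [hB', if_neg (ne_of_mem_erase hc).symm, if_neg fun h => hc' (Fin.ext h)],
              zero_mul]
        · have has : (a : ℕ) + 1 = s := by omega
          rw [has, hs, hpoly_of_neg _ (by have := b.2; omega), mul_zero, neg_zero]
          refine sum_eq_zero fun c hc => ?_
          rw [show B a c = 0 from by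
            rw [hB', if_neg (ne_of_mem_erase hc).symm,
              if_neg fun h => by have := c.2; omega], zero_mul]
    rw [h1, show A a b = hpoly (n + 1) ((r a : ℤ) - a + b) from rfl,
      hpoly_succ_eq_sum n (t a) ((r a : ℤ) - a + b), add_sub_cancel_right]
    have hle := hr (Nat.le_succ a)
    refine sum_bij (fun j _ => r a - j) (fun j hj => ?_) (fun j hj j' hj' h => ?_)
      (fun p hp => ⟨r a - p, ?_, ?_⟩) fun j hj => ?_
    all_goals simp only [t, mem_range, mem_Icc, Nat.succ_eq_add_one] at *
    · omega
    · omega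
    · omega
    · omega
    · rw [show r a - (r a - j) = j by omega]
      congr 2
      push_cast [show j ≤ r a by omega]
      ring
  have h2 : jacobiTrudi (n + 1) (fun a : Fin s => r a) = (B * A).det := by
    rw [Matrix.det_mul, hB, one_mul]
    rfl
  have h3 : B * A = Matrix.of fun a : Fin s => ∑ p ∈ Icc (r (a + 1)) (r a),
      (X n ^ (r a - p) : MvPolynomial ℕ ℤ) • fun b : Fin s => hpoly n ((p : ℤ) - a + b) := by
    ext1 a b
    rw [hBA, Matrix.of_apply, Finset.sum_apply]
    rfl
  rw [h2, h3]
  have h4 := (Matrix.detRowAlternating (n := Fin s)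
    (R := MvPolynomial ℕ ℤ)).toMultilinearMap.map_sum_finset
    (fun (a : Fin s) (p : ℕ) => (X n ^ (r a - p) : MvPolynomial ℕ ℤ) •
      fun b : Fin s => hpoly n ((p : ℤ) - a + b)) (fun a : Fin s => Icc (r (a + 1)) (r a))
  refine h4.trans (sum_congr rfl fun q _ => ?_)
  rw [MultilinearMap.map_smul_univ, prod_pow_eq_pow_sum, smul_eq_mul]
  rfl

end JacobiTrudi

/-! ### Semistandard tableaux -/

section Tableaux

open Finset

/-- The set of semistandard Young tableaux of shape `lam` and content `c`. -/
def tableaux (c : ℕ → ℕ) (lam : YoungDiagram) : Set (SemistandardYoungTableau lam) :=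
  {T | ∀ i, #(lam.cells.filter fun x => T x.1 x.2 = i) = c i}

theorem lt_of_mem_tableaux {c : ℕ → ℕ} {lam : YoungDiagram} {T : SemistandardYoungTableau lam}
    (hT : T ∈ tableaux c lam) {n : ℕ} (hc : ∀ i, n ≤ i → c i = 0) {i j : ℕ} (h : (i, j) ∈ lam) :
    T i j < n := by
  by_contra! hn
  have h1 := hT (T i j)
  rw [hc _ hn, card_eq_zero] at h1
  exact notMem_empty (i, j) (h1 ▸ mem_filter.2 ⟨h, rfl⟩)

theorem finite_tableaux {c : ℕ → ℕ} {n : ℕ} (hc : ∀ i, n ≤ i → c i = 0) (lam : YoungDiagram) :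
    Finite (tableaux c lam) := by
  refine Finite.of_injective (β := lam.cells → Fin n) (fun T x =>
    ⟨T.1 x.1.1 x.1.2, lt_of_mem_tableaux T.2 hc x.2⟩) fun T T' h => Subtype.ext ?_
  refine SemistandardYoungTableau.ext fun i j => ?_
  by_cases hij : (i, j) ∈ lam
  · exact congrArg Fin.val (congrFun h ⟨(i, j), hij⟩)
  · rw [T.1.zeros hij, T'.1.zeros hij]

theorem card_eq_sum_rowLen (lam : YoungDiagram) {s : ℕ} (hs : lam.colLen 0 ≤ s) :
    lam.card = ∑ a : Fin s, lam.rowLen a := by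
  rw [← sum_range (fun a => lam.rowLen a), YoungDiagram.card,
    card_eq_sum_card_fiberwise (f := Prod.fst) (t := range s)]
  · exact sum_congr rfl fun a _ => (lam.rowLen_eq_card).symm
  · intro x hx
    have h1 : (x.1, x.2) ∈ lam := hx
    have h2 := YoungDiagram.mem_iff_lt_colLen.1 (lam.up_left_mem le_rfl (Nat.zero_le x.2) h1)
    exact mem_coe.2 (Finset.mem_range.2 (h2.trans_le hs))

variable {s : ℕ}

/-- The smallest Young diagram whose row `a` has at least `q a` cells, for all `a`. -/
def rowDiagram (q : Fin s → ℕ) : YoungDiagram where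
  cells := univ.biUnion fun a : Fin s => range (a + 1) ×ˢ range (q a)
  isLowerSet := by
    rintro ⟨i, j⟩ ⟨i', j'⟩ ⟨hi, hj⟩ h
    simp only [coe_biUnion, Set.mem_iUnion, mem_coe, mem_product, Finset.mem_range] at *
    obtain ⟨a, ha, h1, h2⟩ := h
    exact ⟨a, ha, by omega, by omega⟩

theorem mem_rowDiagram {q : Fin s → ℕ} (hq : Antitone q) {i j : ℕ} :
    (i, j) ∈ rowDiagram q ↔ ∃ h : i < s, j < q ⟨i, h⟩ := by
  rw [← YoungDiagram.mem_cells, rowDiagram]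
  simp only [mem_biUnion, mem_product, Finset.mem_range, mem_univ, true_and]
  constructor
  · rintro ⟨a, h1, h2⟩
    have h3 : i < s := by omega
    exact ⟨h3, h2.trans_le (hq (Fin.le_def.2 (Nat.lt_succ_iff.1 h1)))⟩
  · exact fun ⟨h, h'⟩ => ⟨⟨i, h⟩, Nat.lt_succ_self i, h'⟩

theorem rowLen_rowDiagram {q : Fin s → ℕ} (hq : Antitone q) (a : Fin s) :
    (rowDiagram q).rowLen a = q a := by
  refine eq_of_forall_lt_iff fun j => ?_
  rw [← YoungDiagram.mem_iff_lt_rowLen, mem_rowDiagram hq]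
  exact ⟨fun ⟨_, h⟩ => h, fun h => ⟨a.2, h⟩⟩

theorem colLen_rowDiagram_le {q : Fin s → ℕ} (hq : Antitone q) : (rowDiagram q).colLen 0 ≤ s := by
  by_contra! h
  obtain ⟨h', -⟩ := (mem_rowDiagram hq).1 (YoungDiagram.mem_iff_lt_colLen.2 h)
  exact lt_irrefl _ h'

variable {kap lam : YoungDiagram}

/-- The restriction of a tableau to a smaller diagram. -/
def restrictTableau (h : kap ≤ lam) (T : SemistandardYoungTableau lam) :
    SemistandardYoungTableau kap where
  entry i j := if (i, j) ∈ kap then T i j else 0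
  row_weak' {i j1 j2} hj hm := by
    rw [if_pos hm, if_pos (kap.up_left_mem le_rfl hj.le hm)]
    exact T.row_weak hj (h hm)
  col_strict' {i1 i2 j} hi hm := by
    rw [if_pos hm, if_pos (kap.up_left_mem hi.le le_rfl hm)]
    exact T.col_strict hi (h hm)
  zeros' hm := if_neg hm

/-- The extension of a tableau with entries less than `n` by the entry `n` on a horizontal strip. -/
def extendTableau (n : ℕ) (hstrip : ∀ i j, (i + 1, j) ∈ lam → (i, j) ∈ kap)
    (h : kap ≤ lam) (T : SemistandardYoungTableau kap) (hT : ∀ i j, (i, j) ∈ kap → T i j < n) :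
    SemistandardYoungTableau lam where
  entry i j := if (i, j) ∈ kap then T i j else if (i, j) ∈ lam then n else 0
  row_weak' {i j1 j2} hj hm := by
    by_cases h2 : (i, j2) ∈ kap
    · rw [if_pos h2, if_pos (kap.up_left_mem le_rfl hj.le h2)]
      exact T.row_weak hj h2
    · rw [if_neg h2, if_pos hm, if_pos (lam.up_left_mem le_rfl hj.le hm)]
      split_ifs with h1
      · exact (hT _ _ h1).le
      · exact le_rfl
  col_strict' {i1 i2 j} hi hm := by
    obtain ⟨i, rfl⟩ : ∃ i, i2 = i + 1 := ⟨i2 - 1, by omega⟩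
    have h1 : (i1, j) ∈ kap := kap.up_left_mem (Nat.lt_succ_iff.1 hi) le_rfl (hstrip i j hm)
    rw [if_pos h1]
    split_ifs with h2
    · exact T.col_strict hi h2
    · exact hT _ _ h1
  zeros' hm := by rw [if_neg fun h' => hm (h h'), if_neg hm]

theorem restrictTableau_apply (h : kap ≤ lam) (T : SemistandardYoungTableau lam) (i j : ℕ) :
    restrictTableau h T i j = if (i, j) ∈ kap then T i j else 0 := rfl

theorem extendTableau_apply (n : ℕ) (hstrip : ∀ i j, (i + 1, j) ∈ lam → (i, j) ∈ kap)
    (h : kap ≤ lam) (T : SemistandardYoungTableau kap) (hT : ∀ i j, (i, j) ∈ kap → T i j < n)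
    (i j : ℕ) : extendTableau n hstrip h T hT i j =
      if (i, j) ∈ kap then T i j else if (i, j) ∈ lam then n else 0 := rfl

/-- Tableaux of shape `lam` and content `c` whose entries less than `n` fill `kap`, where `n` is the
largest entry, correspond to tableaux of shape `kap` with the entry `n` removed from the content. -/
theorem card_tableaux_filling {n : ℕ} {c : ℕ → ℕ} (hc : ∀ i, n + 1 ≤ i → c i = 0)
    (hstrip : ∀ i j, (i + 1, j) ∈ lam → (i, j) ∈ kap) (h : kap ≤ lam) :
    Nat.card {T : tableaux c lam // ∀ i j, (i, j) ∈ lam → (T.1 i j < n ↔ (i, j) ∈ kap)} =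
      if lam.card = kap.card + c n then Nat.card (tableaux (Function.update c n 0) kap) else 0 := by
  have hc' : ∀ i, n ≤ i → Function.update c n 0 i = 0 := fun i hi => by
    rcases hi.eq_or_lt with rfl | hi
    · exact Function.update_self _ _ _
    · rw [Function.update_of_ne hi.ne', hc i hi]
  have hle {T : SemistandardYoungTableau lam} (hT : T ∈ tableaux c lam) {i j : ℕ}
      (hij : (i, j) ∈ lam) : T i j ≤ n := Nat.lt_succ_iff.1 (lt_of_mem_tableaux hT hc hij)
  have hsub : kap.cells ⊆ lam.cells := fun x hx => h hx
  have hcard : #(lam.cells \ kap.cells) = lam.card - kap.card := card_sdiff_of_subset hsub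
  have hcard' : kap.card ≤ lam.card := card_le_card hsub
  -- The cells of a tableau with entries less than `n` exactly on `kap`, sorted by their entries.
  have hfilter (T : SemistandardYoungTableau lam) (hle : ∀ i j, (i, j) ∈ lam → T i j ≤ n)
      (hT : ∀ i j, (i, j) ∈ lam → (T i j < n ↔ (i, j) ∈ kap)) (i : ℕ) :
      lam.cells.filter (fun x => T x.1 x.2 = i) = if i < n then
        kap.cells.filter (fun x => T x.1 x.2 = i) else if i = n then lam.cells \ kap.cells else
          ∅ := by
    ext ⟨a, b⟩
    split_ifs with h1 h2
    · rw [mem_filter, mem_filter]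
      exact ⟨fun ⟨h3, h4⟩ => ⟨(hT a b h3).1 (by simp only at h4; omega), h4⟩,
        fun ⟨h3, h4⟩ => ⟨hsub h3, h4⟩⟩
    · rw [mem_filter, mem_sdiff]
      refine and_congr_right fun h3 => ?_
      have h4 := hT a b h3
      have h5 := hle a b h3
      simp only [YoungDiagram.mem_cells]
      rw [← h4]
      omega
    · refine ⟨fun h3 => ?_, fun h3 => absurd h3 (notMem_empty _)⟩
      rw [mem_filter] at h3
      have := hle a b h3.1
      simp only at h3
      omega
  split_ifs with hn
  · refine Nat.card_congr
      { toFun := fun T => ⟨restrictTableau h T.1.1, fun i => ?_⟩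
        invFun := fun T => ⟨⟨extendTableau n hstrip h T.1 fun i j hij =>
          lt_of_mem_tableaux T.2 hc' hij, fun i => ?_⟩, fun i j hij => ?_⟩
        left_inv := fun T => Subtype.ext (Subtype.ext (SemistandardYoungTableau.ext fun i j => ?_))
        right_inv := fun T => Subtype.ext (SemistandardYoungTableau.ext fun i j => ?_) }
    · have h1 : kap.cells.filter (fun x => restrictTableau h T.1.1 x.1 x.2 = i) =
          kap.cells.filter (fun x => T.1.1 x.1 x.2 = i) := filter_congr fun x hx => by
        rw [restrictTableau_apply, if_pos (c := (x.1, x.2) ∈ kap) hx]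
      rw [h1]
      rcases lt_or_ge i n with hi | hi
      · rw [Function.update_of_ne hi.ne, ← T.1.2 i,
          hfilter T.1.1 (fun _ _ => hle T.1.2) T.2 i, if_pos hi]
      · rw [hc' i hi, card_eq_zero]
        refine filter_eq_empty_iff.2 fun x hx h2 => ?_
        have := (T.2 x.1 x.2 (hsub hx)).2 hx
        omega
    · have h1 (a b : ℕ) (hab : (a, b) ∈ kap) : T.1 a b < n := lt_of_mem_tableaux T.2 hc' hab
      rw [hfilter _ (fun a b hab => ?_) (fun a b hab => ?_)]
      · split_ifs with hi hi'
        · rw [← Function.update_of_ne hi.ne 0 c, ← T.2 i]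
          congr 1
          exact filter_congr fun x hx => by
            rw [extendTableau_apply, if_pos (c := (x.1, x.2) ∈ kap) hx]
        · rw [hcard, hi']
          omega
        · rw [card_empty, hc i (by omega)]
      · rw [extendTableau_apply]
        split_ifs with h2
        · exact (h1 a b h2).le
        · exact le_rfl
      · rw [extendTableau_apply]
        split_ifs with h2
        · exact iff_of_true (h1 a b h2) h2
        · exact iff_of_false (lt_irrefl n) h2
    · change
        extendTableau n hstrip h T.1 (fun i j hij => lt_of_mem_tableaux T.2 hc' hij) i j < n ↔ _
      rw [extendTableau_apply]
      split_ifs with h2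
      · exact iff_of_true (lt_of_mem_tableaux T.2 hc' h2) h2
      · exact iff_of_false (lt_irrefl n) h2
    · rw [extendTableau_apply, restrictTableau_apply]
      split_ifs with h1 h2
      · rfl
      · have h3 := hle T.1.2 h2
        have h4 := T.2 i j h2
        have h5 : ¬ T.1.1 i j < n := fun h => h1 (h4.1 h)
        omega
      · rw [T.1.1.zeros h2]
    · rw [restrictTableau_apply, extendTableau_apply]
      split_ifs with h1
      · rfl
      · rw [T.1.zeros h1]
  · have : IsEmpty {T : tableaux c lam //
        ∀ i j, (i, j) ∈ lam → (T.1 i j < n ↔ (i, j) ∈ kap)} := ⟨fun T => hn ?_⟩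
    · exact Nat.card_of_isEmpty
    · have h1 := T.1.2 n
      rw [hfilter T.1.1 (fun _ _ => hle T.1.2) T.2 n, if_neg (lt_irrefl n), if_pos rfl, hcard] at h1
      omega

theorem antitone_of_mem_piFinset {r : ℕ → ℕ} {q : Fin s → ℕ}
    (hr : Antitone r) (hq : q ∈ Fintype.piFinset fun a : Fin s => Icc (r (a + 1)) (r a)) :
    Antitone q := by
  intro a b hab
  rcases hab.eq_or_lt with rfl | hab
  · exact le_rfl
  · have h1 := Finset.mem_Icc.1 (Fintype.mem_piFinset.1 hq a)
    have h2 := Finset.mem_Icc.1 (Fintype.mem_piFinset.1 hq b)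
    exact h2.2.trans ((hr (Nat.succ_le_of_lt hab)).trans h1.1)

/-- The branching rule for semistandard tableaux: the shape formed by the entries less than the
largest one interlaces with the given shape. -/
theorem card_tableaux_succ {n : ℕ} {c : ℕ → ℕ} (hc : ∀ i, n + 1 ≤ i → c i = 0)
    (hs : lam.colLen 0 ≤ s) : Nat.card (tableaux c lam) =
      ∑ q ∈ Fintype.piFinset fun a : Fin s => Icc (lam.rowLen (a + 1)) (lam.rowLen a),
        if ∑ a : Fin s, (lam.rowLen a - q a) = c n then
          Nat.card (tableaux (Function.update c n 0) (rowDiagram q)) else 0 := by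
  have hanti : Antitone lam.rowLen := fun i j h => lam.rowLen_anti i j h
  have hfin := finite_tableaux hc lam
  have hrow {i j : ℕ} (hij : (i, j) ∈ lam) : i < s :=
    (YoungDiagram.mem_iff_lt_colLen.1 (lam.up_left_mem le_rfl (Nat.zero_le j) hij)).trans_le hs
  let S := Fintype.piFinset fun a : Fin s => Icc (lam.rowLen (a + 1)) (lam.rowLen a)
  let R (T : tableaux c lam) (q : Fin s → ℕ) : Prop :=
    ∀ i j, (i, j) ∈ lam → (T.1 i j < n ↔ (i, j) ∈ rowDiagram q)
  have hex (T : tableaux c lam) : ∃ q, q ∈ S ∧ R T q := by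
    let q (a : Fin s) : ℕ := #((range (lam.rowLen a)).filter fun j => T.1 a j < n)
    have hq (a : Fin s) (j : ℕ) (hj : j < lam.rowLen a) : T.1 a j < n ↔ j < q a := by
      constructor
      · intro h
        have hsub : range (j + 1) ⊆ (range (lam.rowLen a)).filter fun j => T.1 a j < n :=
          fun j' hj' => by
            rw [Finset.mem_range] at hj'
            refine mem_filter.2 ⟨Finset.mem_range.2 (by omega), lt_of_le_of_lt ?_ h⟩
            exact T.1.row_weak_of_le (by omega) (YoungDiagram.mem_iff_lt_rowLen.2 hj)
        have := card_le_card hsub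
        rw [card_range] at this
        exact this
      · intro h
        by_contra hn
        have hsub : ((range (lam.rowLen a)).filter fun j => T.1 a j < n) ⊆ range j :=
          fun j' hj' => by
            rw [mem_filter, Finset.mem_range] at hj'
            rw [Finset.mem_range]
            by_contra! hjj
            exact hn (lt_of_le_of_lt (T.1.row_weak_of_le hjj
              (YoungDiagram.mem_iff_lt_rowLen.2 hj'.1)) hj'.2)
        have := card_le_card hsub
        rw [card_range] at this
        exact absurd h this.not_gt
    have hqS : q ∈ S := by
      refine Fintype.mem_piFinset.2 fun a => Finset.mem_Icc.2 ⟨?_, ?_⟩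
      · by_contra! h
        have h1 : ((a : ℕ) + 1, q a) ∈ lam := YoungDiagram.mem_iff_lt_rowLen.2 h
        have h2 := T.1.col_strict (Nat.lt_add_one (a : ℕ)) h1
        have h3 := lt_of_mem_tableaux T.2 hc h1
        exact lt_irrefl _ ((hq a _ (h.trans_le (hanti (Nat.le_succ a)))).1 (by omega))
      · exact (card_filter_le _ _).trans (card_range _).le
    refine ⟨q, hqS, fun i j hij => ?_⟩
    rw [mem_rowDiagram (antitone_of_mem_piFinset hanti hqS)]
    have h1 := hq ⟨i, hrow hij⟩ j (YoungDiagram.mem_iff_lt_rowLen.1 hij)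
    exact h1.trans ⟨fun h => ⟨hrow hij, h⟩, fun ⟨_, h⟩ => h⟩
  have huniq (T : tableaux c lam) (q q' : Fin s → ℕ) (hq : q ∈ S) (hq' : q' ∈ S) (h : R T q)
      (h' : R T q') : q = q' := by
    funext a
    have hle (q : Fin s → ℕ) (hq : q ∈ S) : q a ≤ lam.rowLen a :=
      (Finset.mem_Icc.1 (Fintype.mem_piFinset.1 hq a)).2
    have key (q q' : Fin s → ℕ) (hq : q ∈ S) (hq' : q' ∈ S) (h : R T q) (h' : R T q') :
        q a ≤ q' a := by
      by_contra! hlt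
      have hm : ((a : ℕ), q' a) ∈ lam :=
        YoungDiagram.mem_iff_lt_rowLen.2 (hlt.trans_le (hle q hq))
      have h1 := (h a (q' a) hm).2
        ((mem_rowDiagram (antitone_of_mem_piFinset hanti hq)).2 ⟨a.2, hlt⟩)
      obtain ⟨_, h2⟩ := (mem_rowDiagram (antitone_of_mem_piFinset hanti hq')).1
        ((h' a (q' a) hm).1 h1)
      exact lt_irrefl _ h2
    exact le_antisymm (key q q' hq hq' h h') (key q' q hq' hq h' h)
  choose f hfS hfR using hex
  have hsum : Nat.card (tableaux c lam) = ∑ q ∈ S, Nat.card {T : tableaux c lam // R T q} := by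
    have := Fintype.ofFinite (tableaux c lam)
    rw [Nat.card_eq_fintype_card, ← card_univ,
      card_eq_sum_card_fiberwise (f := f) (t := S) fun T _ => hfS T]
    refine sum_congr rfl fun q hq => ?_
    rw [Nat.card_eq_fintype_card, Fintype.card_subtype]
    congr 1
    refine filter_congr fun T _ => ⟨fun h => h ▸ hfR T, fun h => ?_⟩
    exact huniq T _ _ (hfS T) hq (hfR T) h
  rw [hsum]
  refine sum_congr rfl fun q hq => ?_
  have hqa := antitone_of_mem_piFinset hanti hq
  have hqI (a : Fin s) := Finset.mem_Icc.1 (Fintype.mem_piFinset.1 hq a)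
  have hle : rowDiagram q ≤ lam := by
    rintro ⟨i, j⟩ hij
    obtain ⟨hi, hj⟩ := (mem_rowDiagram hqa).1 hij
    exact YoungDiagram.mem_iff_lt_rowLen.2 (hj.trans_le (hqI ⟨i, hi⟩).2)
  rw [card_tableaux_filling hc (fun i j hij => ?_) hle]
  · refine if_congr ?_ rfl rfl
    rw [card_eq_sum_rowLen lam hs, card_eq_sum_rowLen _ (colLen_rowDiagram_le hqa),
      sum_tsub_distrib _ fun a _ => (hqI a).2]
    simp only [rowLen_rowDiagram hqa]
    have : ∑ a, q a ≤ ∑ a : Fin s, lam.rowLen a := sum_le_sum fun a _ => (hqI a).2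
    omega
  · have hi := hrow hij
    rw [mem_rowDiagram hqa]
    exact ⟨by omega, (YoungDiagram.mem_iff_lt_rowLen.1 hij).trans_le (hqI ⟨i, by omega⟩).1⟩

/-- The Jacobi--Trudi formula: the coefficients of the determinant count semistandard tableaux, as
both satisfy the same branching rule. -/
theorem coeff_jacobiTrudi (n : ℕ) (c : ℕ →₀ ℕ) (hc : ∀ i, n ≤ i → c i = 0) (lam : YoungDiagram)
    (hs : lam.colLen 0 ≤ s) :
    MvPolynomial.coeff c (jacobiTrudi n fun a : Fin s => lam.rowLen a) =
      Nat.card (tableaux c lam) := by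
  induction n generalizing c lam with
  | zero =>
    obtain rfl : c = 0 := Finsupp.ext fun i => hc i i.zero_le
    by_cases h0 : (0, 0) ∈ lam
    · have h1 : 0 < s := (YoungDiagram.mem_iff_lt_colLen.1 h0).trans_le hs
      have h2 := YoungDiagram.mem_iff_lt_rowLen.1 h0
      have : IsEmpty (tableaux (⇑(0 : ℕ →₀ ℕ)) lam) :=
        ⟨fun T => absurd (lt_of_mem_tableaux T.2 hc h0) (Nat.not_lt_zero _)⟩
      rw [Nat.card_of_isEmpty, jacobiTrudi, Matrix.det_eq_zero_of_row_eq_zero ⟨0, h1⟩,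
        MvPolynomial.coeff_zero, Nat.cast_zero]
      intro b
      rw [Matrix.of_apply, hpoly_zero, if_neg]
      simp only
      omega
    · have hempty (i j : ℕ) : (i, j) ∉ lam := fun h =>
        h0 (lam.up_left_mem i.zero_le j.zero_le h)
      have hrow (i : ℕ) : lam.rowLen i = 0 := by
        by_contra h
        exact hempty i 0 (YoungDiagram.mem_iff_lt_rowLen.2 (Nat.pos_of_ne_zero h))
      have hdet : jacobiTrudi 0 (fun a : Fin s => lam.rowLen a) = 1 := by
        rw [jacobiTrudi, ← Matrix.det_one (n := Fin s)]
        congr 1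
        ext1 a b
        rw [Matrix.of_apply, hpoly_zero, hrow, Matrix.one_apply]
        refine if_congr ?_ rfl rfl
        rw [Fin.ext_iff]
        omega
      have : Unique (tableaux (⇑(0 : ℕ →₀ ℕ)) lam) :=
        { default := ⟨default, fun i => by
            have : lam.cells = ∅ := eq_empty_iff_forall_notMem.2 fun x hx => hempty x.1 x.2 hx
            rw [this]
            rfl⟩
          uniq := fun T => Subtype.ext (SemistandardYoungTableau.ext fun i j => by
            rw [T.1.zeros (hempty i j), SemistandardYoungTableau.zeros _ (hempty i j)]) }
      rw [hdet, Nat.card_unique, MvPolynomial.coeff_one, if_pos rfl, Nat.cast_one]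
  | succ n ih =>
    have hanti : Antitone lam.rowLen := fun i j h => lam.rowLen_anti i j h
    have hzero : lam.rowLen s = 0 := by
      by_contra h
      have := YoungDiagram.mem_iff_lt_colLen.1
        (YoungDiagram.mem_iff_lt_rowLen.2 (Nat.pos_of_ne_zero h))
      omega
    rw [jacobiTrudi_succ n hanti hzero, card_tableaux_succ hc hs, MvPolynomial.coeff_sum,
      Nat.cast_sum]
    refine sum_congr rfl fun q hq => ?_
    have hqa := antitone_of_mem_piFinset hanti hq
    rw [MvPolynomial.X_pow_eq_monomial, MvPolynomial.coeff_monomial_mul', one_mul]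
    have hsub : (c - Finsupp.single n (c n) : ℕ →₀ ℕ) = c.erase n := by
      ext i
      rw [Finsupp.tsub_apply, Finsupp.single_apply]
      rcases eq_or_ne n i with rfl | h
      · rw [if_pos rfl, Finsupp.erase_same, tsub_self]
      · rw [if_neg h, Finsupp.erase_ne h.symm, tsub_zero]
    have herase : ⇑(c.erase n) = Function.update c n 0 := by
      ext i
      rcases eq_or_ne i n with rfl | h
      · rw [Finsupp.erase_same, Function.update_self]
      · rw [Finsupp.erase_ne h, Function.update_of_ne h]
    by_cases he : ∑ a : Fin s, (lam.rowLen a - q a) = c n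
    · rw [if_pos he, he, if_pos (Finsupp.single_le_iff.2 le_rfl), hsub, ← herase,
        ← ih (c.erase n) (fun i hi => ?_) _ (colLen_rowDiagram_le hqa)]
      · simp only [rowLen_rowDiagram hqa]
      · rcases hi.eq_or_lt with rfl | hi
        · exact Finsupp.erase_same
        · rw [Finsupp.erase_ne hi.ne', hc i hi]
    · rw [if_neg he, Nat.cast_zero]
      split_ifs with h1
      · refine coeff_jacobiTrudi_eq_zero le_rfl ?_
        rw [Finsupp.tsub_apply, Finsupp.single_apply, if_pos rfl]
        have := Finsupp.single_le_iff.1 h1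
        omega
      · rfl

end Tableaux

/-! ### Coefficients of the elements `S_λ` -/

section SchurElements

variable {k : Type u} [Field k] [Fintype k]
  {I : Type w} [Quiver.{v} I] [Fintype I] [∀ i j : I, Fintype (i ⟶ j)] {δ : I → ℕ}
  {l : ℕ} {z : Fin l → HomogeneousTube k δ}

theorem coeff_hallS (hz : Function.Injective z) (hdeg : ∀ a, (z a).HasDegree 1)
    (hδ : eulerForm I (fun i => (δ i : ℤ)) (fun i => (δ i : ℤ)) = 0) (hδ0 : δ ≠ 0)
    (lam : YoungDiagram) {ν : Fin l → ℕ} {M : Rep k I}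
    (hM : M.IsOfType δ (fun a => (z a).simple) ν) :
    (hallS k δ lam).coeff (isoClass M) =
      vq k ^ (-((lam.card * ∑ i, δ i : ℕ) : ℤ)) *
        ((MvPolynomial.coeff (extendFin ν)
          (jacobiTrudi l fun a : Fin (lam.colLen 0) => lam.rowLen a) : ℤ) : QSqrt k) := by
  have hterm (σ : Equiv.Perm (Fin (lam.colLen 0))) :
      HallAlgebra.coeff (List.ofFn fun a : Fin (lam.colLen 0) =>
      hallHInt k δ ((lam.rowLen a : ℤ) - (a : ℤ) + (σ a : ℤ))).prod (isoClass M) =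
      vq k ^ (-((lam.card * ∑ i, δ i : ℕ) : ℤ)) * ((MvPolynomial.coeff (extendFin ν)
        (∏ a : Fin (lam.colLen 0),
          hpoly l ((lam.rowLen a : ℤ) - (a : ℤ) + (σ a : ℤ))) : ℤ) : QSqrt k) := by
    have h := coeff_prod_hallHInt hz hdeg hδ hδ0
      (List.ofFn fun a : Fin (lam.colLen 0) => (lam.rowLen a : ℤ) - (a : ℤ) + (σ a : ℤ)) hM
    have hsum : ∑ a : Fin (lam.colLen 0), ((lam.rowLen a : ℤ) - (a : ℤ) + (σ a : ℤ)) =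
        lam.card := by
      rw [card_eq_sum_rowLen lam le_rfl, Finset.sum_add_distrib, Finset.sum_sub_distrib,
        Equiv.sum_comp σ fun a => ((a : ℕ) : ℤ), sub_add_cancel, Nat.cast_sum]
    rw [List.map_ofFn, List.map_ofFn, List.sum_ofFn, hsum, List.prod_ofFn (f := hpoly l ∘ _)] at h
    rw [Nat.cast_mul]
    exact h
  rw [hallS, ← HallAlgebra.coeffHom_apply, map_sum, jacobiTrudi, ← Matrix.det_transpose,
    Matrix.det_apply, MvPolynomial.coeff_sum, Int.cast_sum, Finset.mul_sum]
  refine Finset.sum_congr rfl fun σ _ => ?_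
  rw [map_zsmul, HallAlgebra.coeffHom_apply, hterm, Units.smul_def, MvPolynomial.coeff_smul,
    zsmul_eq_mul, zsmul_eq_mul, Int.cast_mul, mul_left_comm]
  rfl

end SchurElements

end QuiverHall

theorem mainTheorem7 {k : Type*} [Field k] [Fintype k]
    {I : Type*} [Quiver I] [Fintype I] [∀ i j : I, Fintype (i ⟶ j)]
    (hacyclic : QuiverHall.IsAcyclic I) (haffine : QuiverHall.IsAffine I)
    (δ : I → ℕ) (hδ : QuiverHall.IsMinimalImaginaryRoot I δ)
    (lam mu : YoungDiagram) (hcard : lam.card = mu.card)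
    (z : Fin (mu.colLen 0) → QuiverHall.HomogeneousTube k δ)
    (hz : Function.Injective z) (hdeg : ∀ a, (z a).HasDegree 1)
    (N : Fin (mu.colLen 0) → QuiverHall.Rep k I)
    (hN : ∀ a, (z a).IsIndecomposableOfLength (mu.rowLen a) (N a)) :
    (QuiverHall.hallS k δ lam).coeff (QuiverHall.isoClass (QuiverHall.Rep.directSum N)) =
      QuiverHall.vq k ^ (-((lam.card * ∑ i, δ i : ℕ) : ℤ)) *
        (QuiverHall.kostka mu lam : QuiverHall.QSqrt k) := by
  obtain ⟨hδ0, hδδ⟩ := hδ.1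
  have hM : (QuiverHall.Rep.directSum N).IsOfType δ (fun a => (z a).simple)
      (fun a => mu.rowLen a) :=
    ⟨N, fun a => (((z a).isIndecomposableOfLength_iff (hdeg a) hδδ).1 (hN a)).2,
      (QuiverHall.isoSetoid k I).refl _⟩
  have hmu : ⇑(QuiverHall.extendFin fun a : Fin (mu.colLen 0) => mu.rowLen a) = mu.rowLen := by
    funext i
    rcases lt_or_ge i (mu.colLen 0) with h | h
    · exact QuiverHall.extendFin_apply (fun a : Fin (mu.colLen 0) => mu.rowLen a) ⟨i, h⟩
    · rw [QuiverHall.extendFin_of_le _ h]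
      by_contra h'
      exact h.not_gt (YoungDiagram.mem_iff_lt_colLen.1
        (YoungDiagram.mem_iff_lt_rowLen.2 (Nat.pos_of_ne_zero (Ne.symm h'))))
  rw [QuiverHall.coeff_hallS hz hdeg hδδ hδ0 lam hM, QuiverHall.coeff_jacobiTrudi _ _
    (fun i hi => QuiverHall.extendFin_of_le _ hi) lam le_rfl, hmu, Int.cast_natCast]
  rfl
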